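/- Let $K\in\{1,-1\}$ and let $\mathcal N$ be the unit sphere of dimension $d$ (if $K=1$) or the $d$-dimensional hyperbolic space of curvature $-1$ (if $K=-1$), with geodesic distance $d(\cdot,\cdot)$ and exponential map $\mathrm{Exp}$. Write $C_K=\cos$ if $K=1$ and $C_K=\cosh$ if $K=-1$. Let $x_0\in\mathcal N$, let $R\in\mathbb R$ with $R<\pi/2$ if $K=1$, and let $\mathcal M=\mathrm{Exp}_{x_0}(\bar B(0,R))$. Let $h$ be the geodesic map centred at $x_0$ (with $h(x_0)=0$), read in an orthonormal basis of $T_{x_0}\mathcal N$: the gnomonic projection of the open hemisphere around $x_0$ onto $\mathcal B=\mathbb R^d$ if $K=1$, and the Beltrami–Klein projection of $\mathcal N$ onto the open unit ball $\mathcal B=B(0,1)\subset\mathbb R^d$ if $K=-1$. Write $\tilde x=h(x)$. For $x\in\mathcal M$, say that $v\in T_x\mathcal N$ and $\tilde v\in\mathbb R^d$ correspond to each other if they have the same norm and $h$ maps the geodesic ray $\lambda\mapsto\mathrm{Exp}_x(\lambda v)$, followed from $\lambda=0$ within the domain of $h$, onto $\{\tilde x+\tilde\lambda\tilde v:\tilde\lambda\ge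 0\}\cap\mathcal B$. Then the following hold. (a) For all distinct $x,y\in\mathcal M$, $$K\,C_K^2(R)\le K\,\frac{d(x,y)}{\|\tilde x-\tilde y\|}\le K;$$ that is, $\cos^2 R\le d(x,y)/\|\tilde x-\tilde y\|\le 1$ for the sphere and $1\le d(x,y)/\|\tilde x-\tilde y\|\le\cosh^2R$ for the hyperbolic space. (b) For all distinct $x,y\in\mathcal M$ with $x\ne x_0$, let $\tilde\alpha$ be the angle between $\tilde x_0-\tilde x$ and $\tilde y-\tilde x$, and let $\alpha$ be the angle between $\mathrm{Exp}_x^{-1}(x_0)$ and $\mathrm{Exp}_x^{-1}(y)$. Then $$\sin\alpha=\sin\tilde\alpha\sqrt{\frac{1+K\|\tilde x\|^2}{1+K\|\tilde x\|^2\sin^2\tilde\alpha}},\qquad \cos\alpha=\cos\tilde\alpha\sqrt{\frac{1}{1+K\|\tilde x\|^2\sin^2\tilde\alpha}}.$$ (c) Let $x\in\mathcal M$, let $F$ be a real function on $\mathcal N$ that is differentiable at $x$, and let $f=F\circ h^{-1}$. Then $f$ is differentiable at $\tilde x$. Let $\tilde e_1,\dots,\tilde e_d$ be an orthonormal basis of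 $\mathbb R^d$ with $\tilde x\in\mathrm{span}\{\tilde e_1\}$, and let $e_i\in T_x\mathcal N$ be the unit vector corresponding to $\tilde e_i$. Then $e_i\perp e_j$ for $i\ne j$. If moreover $d\ge 2$ and $\nabla f(\tilde x)\in\mathrm{span}\{\tilde e_1,\tilde e_2\}$, then, with $\nabla f(\tilde x)_i=\langle\tilde e_i,\nabla f(\tilde x)\rangle$, $$\nabla F(x)=(1+K\|\tilde x\|^2)\,\nabla f(\tilde x)_1\,e_1+\sqrt{1+K\|\tilde x\|^2}\;\nabla f(\tilde x)_2\,e_2 .$$ Finally, if $v\in T_x\mathcal N$ is normal to $\nabla F(x)$ and $\tilde v$ corresponds to $v$, then $\tilde v$ is normal to $\nabla f(\tilde x)$. -/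

import Mathlib

open Real

noncomputable section

namespace ConstCurv

/-- The linear space `ℝᵈ × ℝ` in which the unit sphere (`K = 1`) and the hyperboloid (`K = -1`)
are embedded. -/
abbrev Ambient (d : ℕ) : Type := EuclideanSpace ℝ (Fin d) × ℝ

/-- The ambient bilinear form `⟨u, v⟩ + K s t`: the Euclidean inner product for `K = 1`, the
Lorentz form for `K = -1`. Restricted to tangent spaces of `spaceForm K d` it is the Riemannian
metric. -/
def form (K : ℝ) {d : ℕ} (p q : Ambient d) : ℝ := inner ℝ p.1 q.1 + K * p.2 * q.2

/-- The complete simply connected space of constant sectional curvature `K ∈ {1, -1}`: the unit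
sphere in `ℝᵈ⁺¹` for `K = 1`, the upper sheet of the hyperboloid for `K = -1`. -/
def spaceForm (K : ℝ) (d : ℕ) : Set (Ambient d) := {p | form K p p = K ∧ (K < 0 → 0 < p.2)}

/-- The tangent space at `x`. -/
def tangentSpace (K : ℝ) {d : ℕ} (x : Ambient d) : Submodule ℝ (Ambient d) where
  carrier := {v | form K x v = 0}
  zero_mem' := by simp [form]
  add_mem' := by
    intro v w hv hw
    simp only [form, Set.mem_ofPred_eq, Prod.fst_add, Prod.snd_add, inner_add_right] at *
    linarith
  smul_mem' := by
    intro c v hv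
    simp only [form, Set.mem_ofPred_eq, Prod.smul_fst, Prod.smul_snd, inner_smul_right,
      smul_eq_mul] at *
    linear_combination c * hv

/-- The Riemannian norm of a tangent vector. -/
def tangentNorm (K : ℝ) {d : ℕ} (v : Ambient d) : ℝ := √(form K v v)

/-- The special cosine `C_K`. -/
def cosK (K t : ℝ) : ℝ := if 0 < K then cos t else cosh t

/-- The special sine `S_K`. -/
def sinK (K t : ℝ) : ℝ := if 0 < K then sin t else sinh t

/-- The exponential map `Exp_x(v)` of the sphere or hyperbolic space: the point at time `1` of the
geodesic from `x` with initial velocity `v` (see `geodesic_velocity`, `geodesic_acceleration`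
and `expMap_mem`). -/
def expMap (K : ℝ) {d : ℕ} (x v : Ambient d) : Ambient d :=
  cosK K (tangentNorm K v) • x + (sinK K (tangentNorm K v) / tangentNorm K v) • v

/-- The geodesic distance of the sphere or hyperbolic space. -/
def geodDist (K : ℝ) {d : ℕ} (x y : Ambient d) : ℝ :=
  if 0 < K then arccos (form K x y) else arcosh (-form K x y)

/-- The inverse exponential map `Exp_x⁻¹(y)` (for `K = 1`: `y` not antipodal to `x`); see
`expMap_logMap` and `tangentNorm_logMap`. -/
def logMap (K : ℝ) {d : ℕ} (x y : Ambient d) : Ambient d :=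
  (geodDist K x y / sinK K (geodDist K x y)) • (y - cosK K (geodDist K x y) • x)

/-- The angle between two tangent vectors at the same point, in the Riemannian metric. -/
def tangentAngle (K : ℝ) {d : ℕ} (u v : Ambient d) : ℝ :=
  arccos (form K u v / (tangentNorm K u * tangentNorm K v))

/-- The manifold `Exp_{x₀}(B̄(0, R))`. -/
def geodBall (K : ℝ) {d : ℕ} (x₀ : Ambient d) (R : ℝ) : Set (Ambient d) :=
  {p | ∃ v ∈ tangentSpace K x₀, tangentNorm K v ≤ R ∧ expMap K x₀ v = p}

/-- `b` is an orthonormal basis of the tangent space at `x₀`. -/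
def IsFrame (K : ℝ) {d : ℕ} (x₀ : Ambient d) (b : Fin d → Ambient d) : Prop :=
  (∀ i, b i ∈ tangentSpace K x₀) ∧ ∀ i j, form K (b i) (b j) = if i = j then 1 else 0

/-- The domain of the geodesic map: the open hemisphere centred at `x₀` for `K = 1`, the whole
hyperbolic space for `K = -1`. -/
def mapDomain (K : ℝ) {d : ℕ} (x₀ : Ambient d) : Set (Ambient d) :=
  {p | p ∈ spaceForm K d ∧ 0 < K * form K p x₀}

/-- The image `𝓑` of the geodesic map: `ℝᵈ` for `K = 1`, the open unit ball for `K = -1`. -/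
def mapImage (K : ℝ) (d : ℕ) : Set (EuclideanSpace ℝ (Fin d)) := {w | 0 < 1 + K * ‖w‖ ^ 2}

/-- The geodesic map `h` centred at `x₀`: central projection from the origin to the affine
hyperplane `x₀ + T_{x₀}`, read in the orthonormal basis `b` of `T_{x₀}`. It is the gnomonic
projection for `K = 1` and the Beltrami-Klein projection for `K = -1`. -/
def geoMap (K : ℝ) {d : ℕ} (x₀ : Ambient d) (b : Fin d → Ambient d) (p : Ambient d) :
    EuclideanSpace ℝ (Fin d) :=
  WithLp.toLp 2 fun i => form K p (b i) / (K * form K p x₀)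

/-- The inverse `h⁻¹` of the geodesic map (on `mapImage K d`); see `geoMap_geoMapInv` and
`geoMapInv_geoMap`. -/
def geoMapInv (K : ℝ) {d : ℕ} (x₀ : Ambient d) (b : Fin d → Ambient d)
    (w : EuclideanSpace ℝ (Fin d)) : Ambient d :=
  (√(1 + K * ‖w‖ ^ 2))⁻¹ • (x₀ + ∑ i, w i • b i)

/-- The tangent vector `v` at `x` and the vector `w ∈ ℝᵈ` correspond to each other (`w = ṽ`): they
have the same norm, and `h` maps the geodesic ray `λ ↦ Exp_x(λ v)`, followed from `λ = 0` as long
as it stays in the domain of `h`, onto the part in `𝓑` of the ray `λ ↦ h(x) + λ w`. -/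
def Corresponds (K : ℝ) {d : ℕ} (x₀ : Ambient d) (b : Fin d → Ambient d) (x v : Ambient d)
    (w : EuclideanSpace ℝ (Fin d)) : Prop :=
  v ∈ tangentSpace K x ∧ ‖w‖ = tangentNorm K v ∧
    ∃ I : Set ℝ, I.OrdConnected ∧ 0 ∈ I ∧ (∀ t ∈ I, 0 ≤ t) ∧
      (∀ t ∈ I, expMap K x (t • v) ∈ mapDomain K x₀) ∧
      {z | z ∈ mapImage K d ∧ ∃ s : ℝ, 0 ≤ s ∧ z = geoMap K x₀ b x + s • w} =
        (fun t : ℝ => geoMap K x₀ b (expMap K x (t • v))) '' I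

/-- `F` (only its values on the manifold matter) is differentiable at the point `x` of the
manifold: it is Fréchet differentiable in normal coordinates. -/
def RiemDifferentiableAt (K : ℝ) {d : ℕ} (F : Ambient d → ℝ) (x : Ambient d) : Prop :=
  DifferentiableAt ℝ (fun v : tangentSpace K x => F (expMap K x v)) 0

/-- `G` is the Riemannian gradient of `F` at `x`: it is tangent at `x`, and `F` is differentiable
at `x` with differential `v ↦ ⟨G, v⟩`. -/
def HasRiemGradientAt (K : ℝ) {d : ℕ} (F : Ambient d → ℝ) (G x : Ambient d) : Prop :=
  G ∈ tangentSpace K x ∧ ∃ L : tangentSpace K x →L[ℝ] ℝ, (∀ v, L v = form K G (v : Ambient d)) ∧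
    HasFDerivAt (fun v : tangentSpace K x => F (expMap K x v)) L 0

theorem form_comm (K : ℝ) {d : ℕ} (p q : Ambient d) : form K p q = form K q p := by
  simp only [form, real_inner_comm]; ring

theorem form_add_left (K : ℝ) {d : ℕ} (p q r : Ambient d) :
    form K (p + q) r = form K p r + form K q r := by
  simp only [form, Prod.fst_add, Prod.snd_add, inner_add_left]; ring

theorem form_smul_left (K c : ℝ) {d : ℕ} (p r : Ambient d) :
    form K (c • p) r = c * form K p r := by
  simp only [form, Prod.smul_fst, Prod.smul_snd, real_inner_smul_left, smul_eq_mul]; ring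

theorem form_add_right (K : ℝ) {d : ℕ} (p q r : Ambient d) :
    form K r (p + q) = form K r p + form K r q := by
  rw [form_comm, form_add_left, form_comm K p, form_comm K q]

theorem form_smul_right (K c : ℝ) {d : ℕ} (p r : Ambient d) :
    form K r (c • p) = c * form K r p := by
  rw [form_comm, form_smul_left, form_comm K p]

theorem form_sum_left (K : ℝ) {d : ℕ} (w : Fin d → ℝ) (b : Fin d → Ambient d) (r : Ambient d) :
    form K (∑ i, w i • b i) r = ∑ i, w i * form K (b i) r := by
  let L : Ambient d →ₗ[ℝ] ℝ :=
    { toFun := fun p => form K p r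
      map_add' := fun p q => form_add_left K p q r
      map_smul' := fun c p => form_smul_left K c p r }
  exact (map_sum L (fun i => w i • b i) Finset.univ).trans
    (Finset.sum_congr rfl fun i _ => form_smul_left K (w i) (b i) r)

theorem snd_sq_le {d : ℕ} {x v : Ambient d} (hx : x ∈ spaceForm (-1) d)
    (hv : v ∈ tangentSpace (-1) x) :
    ‖v.1‖ ^ 2 ≤ x.2 ^ 2 * form (-1) v v ∧ v.2 ^ 2 ≤ (x.2 ^ 2 - 1) * form (-1) v v := by
  have h1 : form (-1) x x = -1 := hx.1
  have h2 : form (-1) x v = 0 := hv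
  have h3 := real_inner_mul_inner_self_le x.1 v.1
  simp only [form, real_inner_self_eq_norm_sq] at *
  have h4 : inner ℝ x.1 v.1 = x.2 * v.2 := by linarith
  rw [h4] at h3
  constructor <;> nlinarith

/-- The form is nonnegative on tangent spaces and vanishes only at `0`. -/
theorem form_self_nonneg {K : ℝ} (hK : K = 1 ∨ K = -1) {d : ℕ} {x v : Ambient d}
    (hx : x ∈ spaceForm K d) (hv : v ∈ tangentSpace K x) :
    0 ≤ form K v v ∧ (form K v v = 0 → v = 0) := by
  rcases hK with rfl | rfl
  · simp only [form, real_inner_self_eq_norm_sq]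
    refine ⟨by nlinarith [sq_nonneg v.2, sq_nonneg ‖v.1‖], fun h => ?_⟩
    have a1 : ‖v.1‖ = 0 := by nlinarith [sq_nonneg v.2, sq_nonneg ‖v.1‖]
    have a2 : v.2 = 0 := by nlinarith [sq_nonneg v.2, sq_nonneg ‖v.1‖]
    exact Prod.ext (norm_eq_zero.1 a1) a2
  · obtain ⟨h1, h2⟩ := snd_sq_le hx hv
    have hp : 0 < x.2 := hx.2 (by norm_num)
    refine ⟨?_, fun h => ?_⟩
    · by_contra hn
      push Not at hn
      nlinarith [sq_nonneg ‖v.1‖, mul_pos hp hp]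
    · rw [h] at h1 h2
      have a1 : ‖v.1‖ = 0 := by nlinarith [sq_nonneg ‖v.1‖]
      have a2 : v.2 = 0 := by nlinarith [sq_nonneg v.2]
      exact Prod.ext (norm_eq_zero.1 a1) a2

theorem tangentNorm_sq {K : ℝ} (hK : K = 1 ∨ K = -1) {d : ℕ} {x v : Ambient d}
    (hx : x ∈ spaceForm K d) (hv : v ∈ tangentSpace K x) : tangentNorm K v ^ 2 = form K v v :=
  Real.sq_sqrt (form_self_nonneg hK hx hv).1

theorem cosK_sq_add {K : ℝ} (hK : K = 1 ∨ K = -1) (t : ℝ) :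
    cosK K t ^ 2 + K * sinK K t ^ 2 = 1 := by
  rcases hK with rfl | rfl
  · simp [cosK, sinK]
  · simp only [cosK, sinK, if_neg (show ¬ (0 : ℝ) < -1 by norm_num)]
    linarith [Real.cosh_sq t]

/-- The exponential map takes its values in the manifold. -/
theorem expMap_mem {K : ℝ} (hK : K = 1 ∨ K = -1) {d : ℕ} {x v : Ambient d}
    (hx : x ∈ spaceForm K d) (hv : v ∈ tangentSpace K x) : expMap K x v ∈ spaceForm K d := by
  have h1 : form K x x = K := hx.1
  have h2 : form K x v = 0 := hv
  have h3 := tangentNorm_sq hK hx hv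
  have h4 := cosK_sq_add hK (tangentNorm K v)
  have hKK : K * K = 1 := by rcases hK with rfl | rfl <;> norm_num
  refine ⟨?_, fun hneg => ?_⟩
  · simp only [expMap, form_add_left, form_add_right, form_smul_left, form_smul_right,
      form_comm K v x, h1, h2, ← h3]
    rcases eq_or_ne (tangentNorm K v) 0 with h0 | h0
    · have : cosK K 0 = 1 := by simp [cosK]
      simp [h0, this]
    · field_simp
      linear_combination (K * tangentNorm K v) * h4 +
        tangentNorm K v * (-sinK K (tangentNorm K v) ^ 2) * hKK
  · have hK' : K = -1 := by rcases hK with rfl | rfl <;> [norm_num at hneg; rfl]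
    subst hK'
    have hp : 0 < x.2 := hx.2 (by norm_num)
    have h5 := (snd_sq_le hx hv).2
    have hn : 0 ≤ tangentNorm (-1) v := Real.sqrt_nonneg _
    simp only [expMap, Prod.snd_add, Prod.smul_snd, smul_eq_mul, cosK, sinK,
      if_neg (show ¬ (0 : ℝ) < -1 by norm_num)]
    set n := tangentNorm (-1) v with hnd
    rcases hn.eq_or_lt with h0 | h0
    · rw [← h0]; simpa using hp
    · rw [← h3] at h5
      have h6 : -(x.2 * n) ≤ v.2 := by
        refine (abs_le_of_sq_le_sq' ?_ (by positivity)).1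
        nlinarith
      have hs : 0 < sinh n := Real.sinh_pos_iff.2 h0
      have h7 : sinh n / n * (-(x.2 * n)) ≤ sinh n / n * v.2 := by gcongr
      have h8 : sinh n / n * (-(x.2 * n)) = -(sinh n * x.2) := by field_simp
      nlinarith [Real.sinh_lt_cosh n]

theorem expMap_smul (K : ℝ) {d : ℕ} (x v : Ambient d) (t : ℝ) :
    expMap K x (t • v) =
      cosK K (t * tangentNorm K v) • x + (sinK K (t * tangentNorm K v) / tangentNorm K v) • v := by
  have hn : tangentNorm K (t • v) = |t| * tangentNorm K v := by
    simp only [tangentNorm, form_smul_left, form_smul_right]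
    rw [← mul_assoc, Real.sqrt_mul (mul_self_nonneg t), Real.sqrt_mul_self_eq_abs]
  rw [expMap, hn, smul_smul]
  rcases eq_or_ne (tangentNorm K v) 0 with h0 | h0
  · simp [h0]
  rcases abs_cases t with ⟨h, ht⟩ | ⟨h, ht⟩
  · rw [h]
    rcases eq_or_lt_of_le ht with h1 | h1
    · simp [← h1, sinK]
    · congr 2; field_simp
  · rw [h]
    have h1 : cosK K (-t * tangentNorm K v) = cosK K (t * tangentNorm K v) := by
      simp [cosK]
    have h2 : sinK K (-t * tangentNorm K v) = -sinK K (t * tangentNorm K v) := by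
      simp only [sinK, neg_mul, Real.sin_neg, Real.sinh_neg]; split_ifs <;> rfl
    have h3 : t ≠ 0 := ht.ne
    rw [h1, h2]
    congr 2
    field_simp

theorem hasDerivAt_cosK {K : ℝ} (hK : K = 1 ∨ K = -1) (t : ℝ) :
    HasDerivAt (cosK K) (-K * sinK K t) t := by
  rcases hK with rfl | rfl
  · have : cosK 1 = cos := by funext s; simp [cosK]
    rw [this]
    simpa [sinK] using Real.hasDerivAt_cos t
  · have : cosK (-1) = cosh := by funext s; simp [cosK, show ¬ (1 : ℝ) < 0 by norm_num]
    rw [this]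
    simpa [sinK, show ¬ (1 : ℝ) < 0 by norm_num] using Real.hasDerivAt_cosh t

theorem hasDerivAt_sinK {K : ℝ} (hK : K = 1 ∨ K = -1) (t : ℝ) :
    HasDerivAt (sinK K) (cosK K t) t := by
  rcases hK with rfl | rfl
  · have : sinK 1 = sin := by funext s; simp [sinK]
    rw [this]
    simpa [cosK] using Real.hasDerivAt_sin t
  · have : sinK (-1) = sinh := by funext s; simp [sinK, show ¬ (1 : ℝ) < 0 by norm_num]
    rw [this]
    simpa [cosK, show ¬ (1 : ℝ) < 0 by norm_num] using Real.hasDerivAt_sinh t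

theorem hasDerivAt_expMap_smul {K : ℝ} (hK : K = 1 ∨ K = -1) {d : ℕ} {x v : Ambient d}
    (hx : x ∈ spaceForm K d) (hv : v ∈ tangentSpace K x) (t : ℝ) :
    HasDerivAt (fun s : ℝ => expMap K x (s • v))
      ((-K * sinK K (t * tangentNorm K v) * tangentNorm K v) • x +
        cosK K (t * tangentNorm K v) • v) t := by
  have hl : HasDerivAt (fun s : ℝ => s * tangentNorm K v) (tangentNorm K v) t := by
    simpa using (hasDerivAt_id t).mul_const (tangentNorm K v)
  have h1 := ((hasDerivAt_cosK hK (t * tangentNorm K v)).comp t hl).smul_const x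
  have h2 := (((hasDerivAt_sinK hK (t * tangentNorm K v)).comp t hl).div_const
    (tangentNorm K v)).smul_const v
  have h3 := h1.add h2
  have he : (fun s : ℝ => expMap K x (s • v)) = fun s : ℝ =>
      cosK K (s * tangentNorm K v) • x + (sinK K (s * tangentNorm K v) / tangentNorm K v) • v :=
    funext fun s => expMap_smul K x v s
  rw [he]
  refine h3.congr_deriv ?_
  congr 1
  rcases eq_or_ne (tangentNorm K v) 0 with h0 | h0
  · have : v = 0 := (form_self_nonneg hK hx hv).2 (by rw [← tangentNorm_sq hK hx hv, h0]; simp)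
    simp [this]
  · field_simp

/-- The curve `t ↦ Exp_x(t v)` has velocity `v` at `t = 0`. -/
theorem geodesic_velocity {K : ℝ} (hK : K = 1 ∨ K = -1) {d : ℕ} {x v : Ambient d}
    (hx : x ∈ spaceForm K d) (hv : v ∈ tangentSpace K x) :
    HasDerivAt (fun t : ℝ => expMap K x (t • v)) v 0 := by
  refine (hasDerivAt_expMap_smul hK hx hv 0).congr_deriv ?_
  simp [cosK, sinK]

/-- The ambient acceleration of `γ(t) = Exp_x(t v)` is a multiple of `γ(t)`, that is, normal to the
manifold: `γ` is a geodesic. -/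
theorem geodesic_acceleration {K : ℝ} (hK : K = 1 ∨ K = -1) {d : ℕ} {x v : Ambient d}
    (hx : x ∈ spaceForm K d) (hv : v ∈ tangentSpace K x) (t : ℝ) :
    HasDerivAt (deriv fun s : ℝ => expMap K x (s • v))
      ((-K * tangentNorm K v ^ 2) • expMap K x (t • v)) t := by
  have he : (deriv fun s : ℝ => expMap K x (s • v)) = fun s : ℝ =>
      (-K * sinK K (s * tangentNorm K v) * tangentNorm K v) • x +
        cosK K (s * tangentNorm K v) • v :=
    funext fun s => (hasDerivAt_expMap_smul hK hx hv s).deriv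
  have hl : HasDerivAt (fun s : ℝ => s * tangentNorm K v) (tangentNorm K v) t := by
    simpa using (hasDerivAt_id t).mul_const (tangentNorm K v)
  have h1 := (((((hasDerivAt_sinK hK (t * tangentNorm K v)).comp t hl).const_mul (-K)).mul_const
    (tangentNorm K v))).smul_const x
  have h2 := ((hasDerivAt_cosK hK (t * tangentNorm K v)).comp t hl).smul_const v
  rw [he, expMap_smul K x v]
  refine (h1.add h2).congr_deriv ?_
  rw [smul_add, smul_smul, smul_smul]
  congr 2
  · ring
  · rcases eq_or_ne (tangentNorm K v) 0 with h0 | h0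
    · simp [h0]
    · field_simp

theorem eq_of_form_eq {K : ℝ} (hK : K = 1 ∨ K = -1) {d : ℕ} {x y : Ambient d}
    (hx : x ∈ spaceForm K d) (hy : y ∈ spaceForm K d) (h : form K x y = K) : x = y := by
  have h1 : form K x x = K := hx.1
  have h2 : form K y y = K := hy.1
  have ht : y + (-1 : ℝ) • x ∈ tangentSpace K x := by
    change form K x _ = 0
    rw [form_add_right, form_smul_right, h, h1]; ring
  have h0 := (form_self_nonneg hK hx ht).2 (by
    simp only [form_add_right, form_smul_right, form_add_left, form_smul_left, h, h1, h2,
      form_comm K y x]; ring)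
  rw [neg_one_smul, add_neg_eq_zero] at h0
  exact h0.symm

/-- `C_K(d(x, y)) = K ⟨x, y⟩`. -/
theorem cosK_geodDist {K : ℝ} (hK : K = 1 ∨ K = -1) {d : ℕ} {x y : Ambient d}
    (hx : x ∈ spaceForm K d) (hy : y ∈ spaceForm K d) :
    cosK K (geodDist K x y) = K * form K x y := by
  have h1 : form K x x = K := hx.1
  have h2 : form K y y = K := hy.1
  rcases hK with rfl | rfl
  · simp only [cosK, geodDist, if_pos one_pos]
    have h3 : form 1 x y ^ 2 ≤ 1 := by
      set c := form 1 x y with hc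
      have : 0 ≤ form 1 (y + (-c) • x) (y + (-c) • x) := by
        simp only [form, real_inner_self_eq_norm_sq]
        nlinarith [sq_nonneg ‖(y + (-c) • x).1‖, sq_nonneg (y + (-c) • x).2]
      simp only [form_add_right, form_smul_right, form_add_left, form_smul_left, h1, h2,
        form_comm 1 y x, ← hc] at this
      nlinarith
    rw [Real.cos_arccos (by nlinarith) (by nlinarith)]; ring
  · simp only [cosK, geodDist, if_neg (show ¬ (0 : ℝ) < -1 by norm_num)]
    rw [Real.cosh_arcosh]
    · ring
    · have hp : 0 < x.2 := hx.2 (by norm_num)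
      have hq : 0 < y.2 := hy.2 (by norm_num)
      have h3 := real_inner_mul_inner_self_le x.1 y.1
      simp only [form, real_inner_self_eq_norm_sq] at *
      have h4 : inner ℝ x.1 y.1 ^ 2 ≤ (x.2 * y.2 - 1) ^ 2 := by nlinarith [sq_nonneg (x.2 - y.2)]
      have h5 : 1 ≤ x.2 * y.2 := by
        have : 1 ≤ x.2 := by nlinarith [sq_nonneg ‖x.1‖]
        have : 1 ≤ y.2 := by nlinarith [sq_nonneg ‖y.1‖]
        nlinarith
      have := (abs_le_of_sq_le_sq' h4 (by linarith)).2
      linarith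

theorem geodDist_sinK {K : ℝ} (hK : K = 1 ∨ K = -1) {d : ℕ} {x y : Ambient d}
    (hx : x ∈ spaceForm K d) (hy : y ∈ spaceForm K d) (hxy : K = 1 → form K x y ≠ -1) :
    0 ≤ geodDist K x y ∧ (sinK K (geodDist K x y) = 0 → geodDist K x y = 0) := by
  have hc := cosK_geodDist hK hx hy
  rcases hK with rfl | rfl
  · simp only [sinK, geodDist, cosK, if_pos one_pos] at *
    refine ⟨Real.arccos_nonneg _, fun h => ?_⟩
    by_contra h0
    have h1 : 0 < arccos (form 1 x y) := lt_of_le_of_ne (Real.arccos_nonneg _) (Ne.symm h0)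
    rcases (Real.arccos_le_pi (form 1 x y)).eq_or_lt with h2 | h2
    · rw [h2, Real.cos_pi] at hc
      exact hxy trivial (by linarith)
    · exact (Real.sin_pos_of_pos_of_lt_pi h1 h2).ne' h
  · simp only [sinK, geodDist, cosK, if_neg (show ¬ (0 : ℝ) < -1 by norm_num)] at *
    have h1 : 1 ≤ -form (-1) x y := by
      have := Real.one_le_cosh (arcosh (-form (-1) x y))
      linarith
    exact ⟨Real.arcosh_nonneg h1, fun h => Real.sinh_eq_zero.1 h⟩

/-- `Exp_x⁻¹(y)` is tangent at `x` and its norm is the distance from `x` to `y`. -/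
theorem tangentNorm_logMap {K : ℝ} (hK : K = 1 ∨ K = -1) {d : ℕ} {x y : Ambient d}
    (hx : x ∈ spaceForm K d) (hy : y ∈ spaceForm K d) (hxy : K = 1 → form K x y ≠ -1) :
    logMap K x y ∈ tangentSpace K x ∧ tangentNorm K (logMap K x y) = geodDist K x y := by
  have h1 : form K x x = K := hx.1
  have h2 : form K y y = K := hy.1
  have hc := cosK_geodDist hK hx hy
  have hs := cosK_sq_add hK (geodDist K x y)
  obtain ⟨hD, hS⟩ := geodDist_sinK hK hx hy hxy
  have hKK : K * K = 1 := by rcases hK with rfl | rfl <;> norm_num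
  have hf : form K x y = K * cosK K (geodDist K x y) := by rw [hc, ← mul_assoc, hKK, one_mul]
  have hl : logMap K x y = (geodDist K x y / sinK K (geodDist K x y)) •
      (y + (-cosK K (geodDist K x y)) • x) := by rw [logMap, neg_smul, sub_eq_add_neg]
  constructor
  · rw [hl]
    change form K x _ = 0
    rw [form_smul_right, form_add_right, form_smul_right, hf, h1]; ring
  · have : form K (logMap K x y) (logMap K x y) = geodDist K x y ^ 2 := by
      rw [hl]
      simp only [form_add_right, form_smul_right, form_add_left, form_smul_left, h1, h2,
        form_comm K y x, hf]
      rcases eq_or_ne (sinK K (geodDist K x y)) 0 with h0 | h0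
      · rw [hS h0]; simp
      · field_simp
        linear_combination
          geodDist K x y ^ 2 * sinK K (geodDist K x y) ^ 2 * hKK - geodDist K x y ^ 2 * K * hs
    rw [tangentNorm, this, Real.sqrt_sq hD]

/-- `Exp_x(Exp_x⁻¹(y)) = y`. -/
theorem expMap_logMap {K : ℝ} (hK : K = 1 ∨ K = -1) {d : ℕ} {x y : Ambient d}
    (hx : x ∈ spaceForm K d) (hy : y ∈ spaceForm K d) (hxy : K = 1 → form K x y ≠ -1) :
    expMap K x (logMap K x y) = y := by
  rw [expMap, (tangentNorm_logMap hK hx hy hxy).2]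
  obtain ⟨-, hS⟩ := geodDist_sinK hK hx hy hxy
  have hc := cosK_geodDist hK hx hy
  rcases eq_or_ne (geodDist K x y) 0 with h0 | h0
  · have h1 : cosK K 0 = 1 := by simp [cosK]
    rw [h0, h1] at hc
    have hxy' : x = y := eq_of_form_eq hK hx hy (by rcases hK with rfl | rfl <;> linarith)
    rw [h0, h1]
    simp [hxy']
  · have h1 : sinK K (geodDist K x y) ≠ 0 := fun h => h0 (hS h)
    rw [logMap, smul_smul]
    have : sinK K (geodDist K x y) / geodDist K x y *
        (geodDist K x y / sinK K (geodDist K x y)) = 1 := by field_simp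
    rw [this, one_smul]; abel

theorem form_frame {K : ℝ} {d : ℕ} {x₀ : Ambient d} (hx₀ : x₀ ∈ spaceForm K d)
    {b : Fin d → Ambient d} (hb : IsFrame K x₀ b) (c : ℝ) (w : Fin d → ℝ) :
    form K (c • x₀ + ∑ i, w i • b i) x₀ = c * K ∧
      ∀ j, form K (c • x₀ + ∑ i, w i • b i) (b j) = w j := by
  have h1 : form K x₀ x₀ = K := hx₀.1
  have h2 : ∀ i, form K x₀ (b i) = 0 := hb.1
  refine ⟨?_, fun j => ?_⟩
  · rw [form_add_left, form_smul_left, form_sum_left, h1]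
    simp [form_comm K _ x₀, h2]
  · simp [form_add_left, form_smul_left, form_sum_left, h2, hb.2]

/-- `h (h⁻¹ w) = w` on the image of `h`. -/
theorem geoMap_geoMapInv {K : ℝ} (hK : K = 1 ∨ K = -1) {d : ℕ} {x₀ : Ambient d}
    (hx₀ : x₀ ∈ spaceForm K d) {b : Fin d → Ambient d} (hb : IsFrame K x₀ b)
    {w : EuclideanSpace ℝ (Fin d)} (hw : w ∈ mapImage K d) :
    geoMap K x₀ b (geoMapInv K x₀ b w) = w := by
  have hs : √(1 + K * ‖w‖ ^ 2) ≠ 0 := (Real.sqrt_pos.2 hw).ne'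
  have hKK : K * K = 1 := by rcases hK with rfl | rfl <;> norm_num
  have h := form_frame hx₀ hb 1 w
  rw [one_smul] at h
  ext i
  simp only [geoMap, geoMapInv, form_smul_left, h.1, h.2]
  rw [one_mul, mul_left_comm, hKK]
  field_simp

/-- `h⁻¹ (h p) = p` on the domain of `h`. -/
theorem geoMapInv_geoMap {K : ℝ} (hK : K = 1 ∨ K = -1) {d : ℕ} {x₀ : Ambient d}
    (hx₀ : x₀ ∈ spaceForm K d) {b : Fin d → Ambient d} (hb : IsFrame K x₀ b)
    {p : Ambient d} (hp : p ∈ mapDomain K x₀) :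
    geoMap K x₀ b p ∈ mapImage K d ∧ geoMapInv K x₀ b (geoMap K x₀ b p) = p := by
  have hKK : K * K = 1 := by rcases hK with rfl | rfl <;> norm_num
  have hK0 : K ≠ 0 := by rintro rfl; simp at hKK
  obtain ⟨⟨hpp, -⟩, hpos⟩ := hp
  -- `x₀` and the frame span the ambient space
  let T : (ℝ × EuclideanSpace ℝ (Fin d)) →ₗ[ℝ] Ambient d :=
    { toFun := fun a => a.1 • x₀ + ∑ i, a.2 i • b i
      map_add' := fun a a' => by
        simp only [Prod.fst_add, Prod.snd_add, PiLp.add_apply, add_smul, Finset.sum_add_distrib]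
        abel
      map_smul' := fun c a => by
        simp [smul_smul, Finset.smul_sum] }
  have hinj : Function.Injective T := by
    rw [← LinearMap.ker_eq_bot, LinearMap.ker_eq_bot']
    intro a ha
    obtain ⟨h1, h2⟩ := form_frame hx₀ hb a.1 a.2
    have ha' : a.1 • x₀ + ∑ i, a.2 i • b i = 0 := ha
    simp only [ha'] at h1 h2
    have hz : ∀ q : Ambient d, form K 0 q = 0 := fun q => by simp [form]
    rw [hz] at h1
    refine Prod.ext ?_ ?_
    · simpa [hK0] using h1.symm
    · ext j; rw [← h2 j, hz]; rfl
  have hsurj : Function.Surjective T :=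
    (LinearMap.injective_iff_surjective_of_finrank_eq_finrank (by simp [add_comm])).1 hinj
  obtain ⟨⟨c, w⟩, hcw⟩ := hsurj p
  have hcw' : c • x₀ + ∑ i, w i • b i = p := hcw
  obtain ⟨h1, h2⟩ := form_frame hx₀ hb c w
  rw [hcw'] at h1 h2
  have hc : 0 < c := by rw [h1, mul_left_comm, hKK] at hpos; linarith
  have hg : geoMap K x₀ b p = c⁻¹ • w := by
    ext i
    simp only [geoMap, h1, h2, PiLp.smul_apply, smul_eq_mul]
    rw [mul_left_comm, hKK, mul_one]; field_simp
  have hnorm : K * c ^ 2 + ‖w‖ ^ 2 = K := by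
    have hpp' : form K p p = K := hpp
    have : form K p p = K * c ^ 2 + ‖w‖ ^ 2 := by
      nth_rewrite 1 [← hcw']
      rw [form_add_left, form_smul_left, form_sum_left, form_comm K x₀ p, h1]
      simp only [form_comm K _ p, h2]
      rw [EuclideanSpace.norm_sq_eq]
      simp only [Real.norm_eq_abs, sq_abs]
      congr 1
      · ring
      · exact Finset.sum_congr rfl fun i _ => by ring
    rw [← this, hpp']
  have hone : 1 + K * ‖c⁻¹ • w‖ ^ 2 = (c⁻¹) ^ 2 := by
    rw [norm_smul, Real.norm_eq_abs, mul_pow, sq_abs]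
    field_simp
    linear_combination K * hnorm + (1 - c ^ 2) * hKK
  constructor
  · rw [hg, mapImage, Set.mem_ofPred_eq, hone]; positivity
  · rw [hg, geoMapInv, hone, Real.sqrt_sq (by positivity), inv_inv, ← hcw', smul_add,
      Finset.smul_sum]
    congr 1
    refine Finset.sum_congr rfl fun i _ => ?_
    rw [smul_smul, PiLp.smul_apply, smul_eq_mul, mul_inv_cancel_left₀ hc.ne']

end ConstCurv

end

noncomputable section

namespace ConstCurv

open Real Filter Topology

/-! Write `B` for `frameMap b`. Every point of the domain of `h` is `x = λ⁻¹ (x₀ + B u)` with `u = h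
x` and `λ = √(1 + K‖u‖²)`, and `B` carries the Euclidean inner product to the ambient form. Hence
`K⟨x, y⟩`, which is `C_K` of the distance, is an explicit expression in `u`, `w` and their inner
product (`form_geoMapInv`); all three statements are computed in the flat model from this.

Distances. On a line whose squared distance from the origin is `ρ`, put `A² = 1 + Kρ` and let `r` be
arclength in the model measured from the foot of the perpendicular. The arclength density of the
space form is then `A / (A² + K r²)`, with primitive `arctan (r/A)` or `artanh (r/A)`
(`exists_chord_arclength`). The addition formula identifies the increment of the primitive with the
distance, and the mean value theorem turns the quotient of distances into the density at an
intermediate point. There `A² + K r²` is `1 + K‖z‖²` at a point `z` of the segment, which lies in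
the image ball because balls are convex.

Angles. The law of cosines (`tangentAngle_logMap`) expresses `cos α` by forms and by sines of
distances. The Gram determinant of `u, w` is `‖u‖² ‖u - w‖² sin² α̃`, and this produces the factor
`1 + K‖u‖² sin² α̃`.

Gradients. `Exp_x⁻¹(y)` is the tangential projection of `y` times `d / S_K(d)`, a factor tending to
`1`. So in normal coordinates `h⁻¹` has differential `λ⁻¹ P B`, with `P` the projection to `T_x`
(`hasFDerivAt_comp_geoMapInv`). The metric pulled back by `P B` is `⟨w, w'⟩ - K⟨u, w⟩⟨u, w'⟩ / λ²`,
diagonal in any orthonormal basis containing the direction of `u`. Corresponding vectors satisfy `v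
= κ P B w` with `κ > 0` (`Corresponds.exists_eq`). Equality of norms forces `κ = λ` in the radial
and `κ = 1` in the orthogonal directions, and the gradient formula follows. -/

/-- The vector with coordinates `w` in the system `b`. -/
def frameMap {d : ℕ} (b : Fin d → Ambient d) : EuclideanSpace ℝ (Fin d) →ₗ[ℝ] Ambient d where
  toFun w := ∑ i, w i • b i
  map_add' w w' := by simp only [PiLp.add_apply, add_smul, Finset.sum_add_distrib]
  map_smul' c w := by simp [smul_smul, Finset.smul_sum]

theorem mul_self_of_curvature {K : ℝ} (hK : K = 1 ∨ K = -1) : K * K = 1 := by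
  rcases hK with rfl | rfl <;> norm_num

theorem geoMapInv_eq (K : ℝ) {d : ℕ} (x₀ : Ambient d) (b : Fin d → Ambient d)
    (w : EuclideanSpace ℝ (Fin d)) :
    geoMapInv K x₀ b w = (√(1 + K * ‖w‖ ^ 2))⁻¹ • (x₀ + frameMap b w) := rfl

/-! ### Coordinates adapted to the base point. -/

section Frame

variable {K : ℝ} {d : ℕ} {x₀ : Ambient d} {b : Fin d → Ambient d}

theorem form_frameMap_base (hb : IsFrame K x₀ b) (w : EuclideanSpace ℝ (Fin d)) :
    form K (frameMap b w) x₀ = 0 := by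
  have h2 : ∀ i, form K x₀ (b i) = 0 := hb.1
  refine (form_sum_left K w b x₀).trans ?_
  simp [form_comm K _ x₀, h2]

theorem form_frameMap (hb : IsFrame K x₀ b) (w w' : EuclideanSpace ℝ (Fin d)) :
    form K (frameMap b w) (frameMap b w') = inner ℝ w w' := by
  have h (j : Fin d) : form K (b j) (frameMap b w') = w' j := by
    rw [form_comm]
    refine (form_sum_left K w' b (b j)).trans ?_
    simp [hb.2]
  refine (form_sum_left K w b _).trans ?_
  simp only [h, PiLp.inner_apply, RCLike.inner_apply, conj_trivial]
  exact Finset.sum_congr rfl fun i _ => mul_comm _ _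

/-- The base point and the frame span the ambient space. -/
theorem exists_frame_coords (hK : K = 1 ∨ K = -1) (hx₀ : x₀ ∈ spaceForm K d)
    (hb : IsFrame K x₀ b) (p : Ambient d) :
    ∃ (c : ℝ) (w : EuclideanSpace ℝ (Fin d)), p = c • x₀ + frameMap b w := by
  have h0 : form K x₀ x₀ = K := hx₀.1
  have hK0 : K ≠ 0 := by rcases hK with rfl | rfl <;> norm_num
  let T : (ℝ × EuclideanSpace ℝ (Fin d)) →ₗ[ℝ] Ambient d :=
    (LinearMap.toSpanSingleton ℝ _ x₀).coprod (frameMap b)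
  have hT (a) : T a = a.1 • x₀ + frameMap b a.2 := by simp [T]
  have hz : ∀ q : Ambient d, form K 0 q = 0 := fun q => by simp [form]
  have hinj : Function.Injective T := by
    rw [← LinearMap.ker_eq_bot, LinearMap.ker_eq_bot']
    intro a ha
    rw [hT] at ha
    -- Pairing with `x₀` isolates the first coordinate. Pairing with the frame part gives its
    -- squared Euclidean norm, since the form is positive definite on the span of the frame even
    -- when `K = -1`.
    have h1 : form K (a.1 • x₀ + frameMap b a.2) x₀ = 0 := by rw [ha, hz]
    have h2 : form K (a.1 • x₀ + frameMap b a.2) (frameMap b a.2) = 0 := by rw [ha, hz]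
    rw [form_add_left, form_smul_left, form_frameMap_base hb, h0] at h1
    rw [form_add_left, form_smul_left, form_comm K x₀, form_frameMap_base hb,
      form_frameMap hb] at h2
    refine Prod.ext ?_ ?_
    · simpa [hK0] using h1
    · simpa using h2
  have hsurj : Function.Surjective T :=
    (LinearMap.injective_iff_surjective_of_finrank_eq_finrank (by simp [add_comm])).1 hinj
  obtain ⟨a, ha⟩ := hsurj p
  exact ⟨a.1, a.2, by rw [← hT, ha]⟩

/-- The cross terms vanish because the frame is orthogonal to `x₀`. By `cosK_geodDist` the left side
is `C_K` of the distance, so this is the distance formula of the model. -/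
theorem form_geoMapInv (hx₀ : x₀ ∈ spaceForm K d) (hb : IsFrame K x₀ b)
    (hK : K = 1 ∨ K = -1) (u w : EuclideanSpace ℝ (Fin d)) :
    K * form K (geoMapInv K x₀ b u) (geoMapInv K x₀ b w) =
      (1 + K * inner ℝ u w) / (√(1 + K * ‖u‖ ^ 2) * √(1 + K * ‖w‖ ^ 2)) := by
  have h0 : form K x₀ x₀ = K := hx₀.1
  simp only [geoMapInv_eq, form_smul_left, form_smul_right, form_add_left, form_add_right,
    form_frameMap_base hb, form_frameMap hb, form_comm K x₀, h0]
  rw [div_eq_mul_inv, mul_inv]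
  linear_combination (√(1 + K * ‖u‖ ^ 2))⁻¹ * (√(1 + K * ‖w‖ ^ 2))⁻¹ * mul_self_of_curvature hK

theorem geoMapInv_mem (hK : K = 1 ∨ K = -1) (hx₀ : x₀ ∈ spaceForm K d) (hb : IsFrame K x₀ b)
    {w : EuclideanSpace ℝ (Fin d)} (hw : w ∈ mapImage K d) :
    geoMapInv K x₀ b w ∈ spaceForm K d := by
  have ha : 0 < 1 + K * ‖w‖ ^ 2 := hw
  have hs := Real.sqrt_pos.2 ha
  have hs2 := Real.mul_self_sqrt ha.le
  have hKK := mul_self_of_curvature hK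
  refine ⟨?_, fun hneg => ?_⟩
  · have h := form_geoMapInv hx₀ hb hK w w
    rw [real_inner_self_eq_norm_sq, hs2, div_self ha.ne'] at h
    linear_combination K * h - form K (geoMapInv K x₀ b w) (geoMapInv K x₀ b w) * hKK
  · have hK' : K = -1 := by rcases hK with rfl | rfl <;> [norm_num at hneg; rfl]
    subst hK'
    have h5 := (snd_sq_le hx₀ (v := frameMap b w) ((form_comm _ _ _).trans
      (form_frameMap_base hb w))).2
    have hp : 0 < x₀.2 := hx₀.2 (by norm_num)
    rw [form_frameMap hb, real_inner_self_eq_norm_sq] at h5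
    rw [geoMapInv_eq, Prod.smul_snd, smul_eq_mul, Prod.snd_add]
    refine mul_pos (inv_pos.2 hs) ?_
    -- The upper sheet: `‖w‖ < 1` keeps the last coordinate of the tangent vector below that of `x₀`
    -- in absolute value.
    have : (frameMap b w).2 ^ 2 < x₀.2 ^ 2 := by nlinarith [sq_nonneg ‖w‖, mul_pos hp hp]
    linarith [(abs_lt_of_sq_lt_sq' this hp.le).1]

/-- The geodesic ball lies in the domain of the geodesic map, and its image in a Euclidean ball. -/
theorem geodBall_mem (hK : K = 1 ∨ K = -1) {R : ℝ} (hR : K = 1 → R < π / 2)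
    (hx₀ : x₀ ∈ spaceForm K d) (hb : IsFrame K x₀ b) {x : Ambient d} (hx : x ∈ geodBall K x₀ R) :
    x ∈ mapDomain K x₀ ∧
      K * (1 + K * ‖geoMap K x₀ b x‖ ^ 2) * cosK K R ^ 2 ≤ K := by
  obtain ⟨v, hv, hvR, rfl⟩ := hx
  have h0 : form K x₀ x₀ = K := hx₀.1
  have hKK := mul_self_of_curvature hK
  have hv' : form K v x₀ = 0 := (form_comm _ _ _).trans hv
  have hn : 0 ≤ tangentNorm K v := Real.sqrt_nonneg _
  have hf : K * form K (expMap K x₀ v) x₀ = cosK K (tangentNorm K v) := by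
    simp only [expMap, form_add_left, form_smul_left, hv', h0]
    linear_combination cosK K (tangentNorm K v) * hKK
  have hpos : 0 < cosK K (tangentNorm K v) := by
    rcases hK with rfl | rfl
    · simp only [cosK, if_pos one_pos]
      exact Real.cos_pos_of_mem_Ioo ⟨by linarith [Real.pi_pos], by linarith [hR rfl]⟩
    · simp only [cosK, if_neg (show ¬ (0 : ℝ) < -1 by norm_num)]
      exact Real.cosh_pos _
  have hdom : expMap K x₀ v ∈ mapDomain K x₀ := ⟨expMap_mem hK hx₀ hv, by rwa [hf]⟩
  refine ⟨hdom, ?_⟩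
  obtain ⟨him, hinv⟩ := geoMapInv_geoMap hK hx₀ hb hdom
  set u := geoMap K x₀ b (expMap K x₀ v)
  have ha : 0 < 1 + K * ‖u‖ ^ 2 := him
  -- Two evaluations of `K⟨x, x₀⟩`: along the geodesic from `x₀`, and in the coordinates of the
  -- model.
  have hc : cosK K (tangentNorm K v) = (√(1 + K * ‖u‖ ^ 2))⁻¹ := by
    rw [← hf, ← hinv, geoMapInv_eq, form_smul_left, form_add_left, form_frameMap_base hb, h0]
    linear_combination (√(1 + K * ‖u‖ ^ 2))⁻¹ * hKK
  have hc2 : (1 + K * ‖u‖ ^ 2) * cosK K (tangentNorm K v) ^ 2 = 1 := by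
    rw [hc, inv_pow, Real.sq_sqrt ha.le, mul_inv_cancel₀ ha.ne']
  have hcR : K * cosK K R ^ 2 ≤ K * cosK K (tangentNorm K v) ^ 2 := by
    rcases hK with rfl | rfl
    · simp only [cosK, if_pos one_pos, one_mul]
      have h1 : cos R ≤ cos (tangentNorm 1 v) :=
        Real.cos_le_cos_of_nonneg_of_le_pi hn (by linarith [hR rfl, Real.pi_pos]) hvR
      have h2 : 0 ≤ cos R := Real.cos_nonneg_of_mem_Icc
        ⟨by linarith [Real.pi_pos], (hR rfl).le⟩
      gcongr
    · simp only [cosK, if_neg (show ¬ (0 : ℝ) < -1 by norm_num)]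
      have h1 : cosh (tangentNorm (-1) v) ≤ cosh R := by
        rw [Real.cosh_le_cosh, abs_of_nonneg hn]; exact hvR.trans (le_abs_self R)
      nlinarith [Real.cosh_pos (tangentNorm (-1) v)]
  have := mul_le_mul_of_nonneg_left hcR ha.le
  linear_combination this + K * hc2

end Frame

/-! ### Arclength along a chord. -/

theorem hasDerivAt_artanh {x : ℝ} (hx : x ∈ Set.Ioo (-1) 1) :
    HasDerivAt artanh (1 - x ^ 2)⁻¹ x := by
  have h1 : 0 < 1 + x := by linarith [hx.1]
  have h2 : 0 < 1 - x := by linarith [hx.2]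
  have h : HasDerivAt (fun y : ℝ => 1 / 2 * (log (1 + y) - log (1 - y))) (1 - x ^ 2)⁻¹ x := by
    have a1 := ((hasDerivAt_id x).const_add 1).log h1.ne'
    have a2 := ((hasDerivAt_id x).const_sub 1).log h2.ne'
    refine ((a1.sub a2).const_mul (1 / 2)).congr_deriv ?_
    have h3 : 1 - x ^ 2 ≠ 0 := by nlinarith
    simp only [id]
    field_simp
    ring
  refine h.congr_of_eventuallyEq ?_
  filter_upwards [isOpen_Ioo.mem_nhds hx] with y hy
  rw [artanh_eq_half_log (Set.Ioo_subset_Icc_self hy), Real.log_div] <;> linarith [hy.1, hy.2]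

/-- The arclength along a chord at distance `A` (up to sign) from the origin of the model. -/
theorem exists_chord_arclength {K : ℝ} (hK : K = 1 ∨ K = -1) {A s t : ℝ} (hA : 0 < A)
    (hs : 0 < A ^ 2 + K * s ^ 2) (ht : 0 < A ^ 2 + K * t ^ 2) :
    ∃ c : ℝ → ℝ, (∀ r ∈ Set.Icc s t, HasDerivAt c (A / (A ^ 2 + K * r ^ 2)) r) ∧
      cosK K (c t - c s) = (A ^ 2 + K * (s * t)) / (√(A ^ 2 + K * s ^ 2) * √(A ^ 2 + K * t ^ 2)) ∧
      (K = 1 → c t - c s ≤ π) := by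
  have hsc (y : ℝ) (hy : 0 < A ^ 2 + K * y ^ 2) :
      √(A ^ 2 + K * y ^ 2) = A * √(1 + K * (y / A) ^ 2) := by
    have : A ^ 2 + K * y ^ 2 = A ^ 2 * (1 + K * (y / A) ^ 2) := by field_simp
    rw [this, Real.sqrt_mul (by positivity), Real.sqrt_sq hA.le]
  have hp (y : ℝ) (hy : 0 < A ^ 2 + K * y ^ 2) : 0 < √(1 + K * (y / A) ^ 2) := by
    have h1 := Real.sqrt_pos.2 hy
    rw [hsc y hy] at h1
    exact pos_of_mul_pos_right h1 hA.le
  have hs1 := hp s hs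
  have ht1 := hp t ht
  rw [hsc s hs, hsc t ht]
  rcases hK with rfl | rfl
  · refine ⟨fun r => arctan (r / A), fun r _ => ?_, ?_, fun _ => ?_⟩
    · refine (((hasDerivAt_id r).div_const A).arctan).congr_deriv ?_
      simp only [id]
      field_simp
    · simp only [cosK, if_pos one_pos, Real.cos_sub, Real.cos_arctan, Real.sin_arctan, one_mul]
        at *
      field_simp
    · linarith [Real.arctan_lt_pi_div_two (t / A), Real.neg_pi_div_two_lt_arctan (s / A)]
  · have hI (y : ℝ) (h1 : y ^ 2 < A ^ 2) : y / A ∈ Set.Ioo (-1) 1 := by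
      obtain ⟨h2, h3⟩ := abs_lt_of_sq_lt_sq' h1 hA.le
      exact ⟨by rw [lt_div_iff₀ hA]; linarith, by rw [div_lt_iff₀ hA]; linarith⟩
    have hs2 : s ^ 2 < A ^ 2 := by linarith
    have ht2 : t ^ 2 < A ^ 2 := by linarith
    refine ⟨fun r => artanh (r / A), fun r hr => ?_, ?_, fun h => by norm_num at h⟩
    · have hr2 : r ^ 2 < A ^ 2 := by
        have h1 := abs_lt_of_sq_lt_sq' hs2 hA.le
        have h2 := abs_lt_of_sq_lt_sq' ht2 hA.le
        exact sq_lt_sq' (by linarith [hr.1]) (by linarith [hr.2])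
      refine ((hasDerivAt_artanh (hI r hr2)).comp r
        ((hasDerivAt_id r).div_const A)).congr_deriv ?_
      have h3 : A ^ 2 + -1 * r ^ 2 ≠ 0 := by linarith
      have h4 : 1 - (r / A) ^ 2 ≠ 0 := by
        have : A ^ 2 + -1 * r ^ 2 = A ^ 2 * (1 - (r / A) ^ 2) := by field_simp; ring
        rw [this] at h3
        exact right_ne_zero_of_mul h3
      have h5 : A ^ 2 - r ^ 2 ≠ 0 := by linarith
      rw [div_pow, one_sub_div (by positivity)]
      rw [neg_one_mul, ← sub_eq_add_neg]
      field_simp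
    · simp only [cosK, if_neg (show ¬ (0 : ℝ) < -1 by norm_num), Real.cosh_sub,
        cosh_artanh (hI s hs2), cosh_artanh (hI t ht2), sinh_artanh (hI s hs2),
        sinh_artanh (hI t ht2), neg_one_mul, ← sub_eq_add_neg] at *
      field_simp

theorem eq_of_cosK_eq {K : ℝ} (hK : K = 1 ∨ K = -1) {s t : ℝ} (hs : 0 ≤ s) (ht : 0 ≤ t)
    (hsp : K = 1 → s ≤ π) (htp : K = 1 → t ≤ π) (h : cosK K s = cosK K t) : s = t := by
  rcases hK with rfl | rfl
  · simp only [cosK, if_pos one_pos] at h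
    exact Real.injOn_cos ⟨hs, hsp rfl⟩ ⟨ht, htp rfl⟩ h
  · simp only [cosK, if_neg (show ¬ (0 : ℝ) < -1 by norm_num)] at h
    rw [← Real.arcosh_cosh hs, h, Real.arcosh_cosh ht]

/-! ### Distance deformation. -/

section Frame

variable {K : ℝ} {d : ℕ} {x₀ : Ambient d} {b : Fin d → Ambient d}

/-- Two points of an open hemisphere are not antipodal. -/
theorem form_geoMapInv_ne (hK : K = 1 ∨ K = -1) (hx₀ : x₀ ∈ spaceForm K d)
    (hb : IsFrame K x₀ b) {u w : EuclideanSpace ℝ (Fin d)}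
    (hu : u ∈ mapImage K d) (hw : w ∈ mapImage K d) :
    K = 1 → form K (geoMapInv K x₀ b u) (geoMapInv K x₀ b w) ≠ -1 := by
  rintro rfl h
  have h1 := form_geoMapInv hx₀ hb hK u w
  have ha : 0 < 1 + 1 * ‖u‖ ^ 2 := hu
  have hc : 0 < 1 + 1 * ‖w‖ ^ 2 := hw
  have := Real.sqrt_pos.2 ha
  have := Real.sqrt_pos.2 hc
  rw [h, eq_div_iff (by positivity)] at h1
  -- Antipodality would make `⟨u, w⟩` smaller than minus the product of the two roots, but
  -- Cauchy–Schwarz bounds it below by `-‖u‖ ‖w‖`, and each root exceeds the norm.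
  have h4 := neg_le_of_abs_le (abs_real_inner_le_norm u w)
  have h5 : ‖u‖ < √(1 + 1 * ‖u‖ ^ 2) := Real.lt_sqrt_of_sq_lt (by linarith)
  have h6 : ‖w‖ < √(1 + 1 * ‖w‖ ^ 2) := Real.lt_sqrt_of_sq_lt (by linarith)
  have h7 := mul_lt_mul'' h5 h6 (norm_nonneg _) (norm_nonneg _)
  linarith

/-- Distances in the space form and in the image of the geodesic map. -/
theorem geodDist_geoMapInv_bounds (hK : K = 1 ∨ K = -1) (hx₀ : x₀ ∈ spaceForm K d)
    (hb : IsFrame K x₀ b) {u w : EuclideanSpace ℝ (Fin d)} (huw : u ≠ w)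
    (hu : u ∈ mapImage K d) (hw : w ∈ mapImage K d) {C : ℝ}
    (hCu : K * (1 + K * ‖u‖ ^ 2) * C ≤ K) (hCw : K * (1 + K * ‖w‖ ^ 2) * C ≤ K) (hC : 0 ≤ C) :
    K * C ≤ K * (geodDist K (geoMapInv K x₀ b u) (geoMapInv K x₀ b w) / ‖u - w‖) ∧
      K * (geodDist K (geoMapInv K x₀ b u) (geoMapInv K x₀ b w) / ‖u - w‖) ≤ K := by
  have hKK := mul_self_of_curvature hK
  have hum := geoMapInv_mem hK hx₀ hb hu
  have hwm := geoMapInv_mem hK hx₀ hb hw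
  have hl : 0 < ‖u - w‖ := norm_pos_iff.2 (sub_ne_zero.2 huw)
  set l := ‖u - w‖ with hld
  have hl2 : l ^ 2 = ‖u‖ ^ 2 - 2 * inner ℝ u w + ‖w‖ ^ 2 := norm_sub_sq_real u w
  set g := inner ℝ u w with hg
  have hcs : g ^ 2 ≤ ‖u‖ ^ 2 * ‖w‖ ^ 2 := by
    have := real_inner_mul_inner_self_le u w
    simp only [real_inner_self_eq_norm_sq] at this
    linarith
  set p := ‖u‖ ^ 2 with hp
  set q := ‖w‖ ^ 2 with hq
  -- `s` and `t` are the signed positions of `u` and `w` on their common line, in the direction `w -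
  -- u`, measured from the foot of the perpendicular from the origin. The squared distance of the
  -- line from the origin is `p - s² = q - t²`.
  set s := (g - p) / l with hs
  set t := (q - g) / l with ht
  have hst : t - s = l := by rw [ht, hs]; field_simp; linarith
  have hs' : s * l = g - p := by rw [hs]; field_simp
  have ht' : t * l = q - g := by rw [ht]; field_simp
  have hrho : 0 ≤ p - s ^ 2 := by
    have : 0 ≤ (p - s ^ 2) * l ^ 2 := by
      have : (p - s ^ 2) * l ^ 2 = p * q - g ^ 2 := by
        linear_combination p * hl2 - (s * l + (g - p)) * hs'
      linarith
    exact nonneg_of_mul_nonneg_left this (by positivity)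
  have ht2 : q - t ^ 2 = p - s ^ 2 := by
    linear_combination (-(t + s)) * hst - hs' - ht'
  have hgs : g = p - s ^ 2 + s * t := by linear_combination -hs' - s * hst
  have hp0 : 0 < 1 + K * p := hu
  have hq0 : 0 < 1 + K * q := hw
  have hA2 : 0 < 1 + K * (p - s ^ 2) := by
    rcases hK with rfl | rfl <;> linarith [sq_nonneg s]
  set A := √(1 + K * (p - s ^ 2)) with hA
  have hApos : 0 < A := Real.sqrt_pos.2 hA2
  have hAsq : A ^ 2 = 1 + K * (p - s ^ 2) := Real.sq_sqrt hA2.le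
  have e1 : A ^ 2 + K * s ^ 2 = 1 + K * p := by rw [hAsq]; ring
  have e2 : A ^ 2 + K * t ^ 2 = 1 + K * q := by rw [hAsq]; linear_combination -K * ht2
  have e3 : A ^ 2 + K * (s * t) = 1 + K * g := by rw [hAsq, hgs]; ring
  obtain ⟨c, hc1, hc2, hc3⟩ := exists_chord_arclength hK (s := s) (t := t) hApos
    (by rw [e1]; exact hp0) (by rw [e2]; exact hq0)
  have hlt : s < t := by linarith
  -- Mean value theorem: the quotient of the two distances is the density at an interior `r`.
  obtain ⟨r, hr, hrc⟩ := exists_hasDerivAt_eq_slope c (fun r => A / (A ^ 2 + K * r ^ 2)) hlt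
    (fun r hr => (hc1 r hr).continuousAt.continuousWithinAt)
    (fun r hr => hc1 r (Set.Ioo_subset_Icc_self hr))
  rw [hst] at hrc
  have hr2 : r ^ 2 ≤ s ^ 2 ∨ r ^ 2 ≤ t ^ 2 := by
    rcases le_total 0 r with h0 | h0
    · exact Or.inr (pow_le_pow_left₀ h0 hr.2.le 2)
    · refine Or.inl (sq_le_sq.2 ?_)
      rw [abs_of_nonpos h0, abs_of_nonpos (hr.1.le.trans h0)]
      exact neg_le_neg hr.1.le
  -- The bound on the norm passes from the farther endpoint to the intermediate point. One argument
  -- serves both signs, because `r²` enters with coefficient `K * K = 1`.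
  have hmid1 : K * (A ^ 2 + K * r ^ 2) * C ≤ K := by
    have h2 : r ^ 2 * C ≤ s ^ 2 * C ∨ r ^ 2 * C ≤ t ^ 2 * C :=
      hr2.imp (mul_le_mul_of_nonneg_right · hC) (mul_le_mul_of_nonneg_right · hC)
    rw [← e1] at hCu
    rw [← e2] at hCw
    rcases h2 with h2 | h2
    · linear_combination hCu + h2 + (r ^ 2 - s ^ 2) * C * hKK
    · linear_combination hCw + h2 + (r ^ 2 - t ^ 2) * C * hKK
  have hmid2 : 0 < A ^ 2 + K * r ^ 2 := by
    rcases hK with rfl | rfl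
    · positivity
    · rcases hr2 with h1 | h1 <;> linarith
  -- Both sides have the same `C_K` and lie where `C_K` is injective: they are nonnegative, and at
  -- most `π` on the sphere.
  have hD : geodDist K (geoMapInv K x₀ b u) (geoMapInv K x₀ b w) = c t - c s := by
    have hpos : 0 < c t - c s := by
      have : 0 < (c t - c s) / l := by rw [← hrc]; positivity
      exact (div_pos_iff_of_pos_right hl).1 this
    refine eq_of_cosK_eq hK (geodDist_sinK hK hum hwm (form_geoMapInv_ne hK hx₀ hb hu hw)).1
      hpos.le (fun h => ?_) hc3 ?_
    · rw [geodDist, if_pos (by rw [h]; exact one_pos)]; exact Real.arccos_le_pi _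
    · rw [cosK_geodDist hK hum hwm, form_geoMapInv hx₀ hb hK, hc2, e1, e2, e3]
  rw [hD, ← hrc]
  rcases hK with rfl | rfl
  · have h1 : 1 ≤ A := by rw [hA, Real.one_le_sqrt]; linarith
    have h2 : A ≤ A ^ 2 + 1 * r ^ 2 := by nlinarith [sq_nonneg r]
    refine ⟨?_, ?_⟩
    · rw [one_mul, one_mul, le_div_iff₀ hmid2]; linarith
    · rw [one_mul, div_le_one hmid2]; exact h2
  · have h1 : A ≤ 1 := by rw [hA, Real.sqrt_le_one]; linarith
    have h2 : A ^ 2 + -1 * r ^ 2 ≤ A := by nlinarith [sq_nonneg r]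
    have h3 : 1 ≤ A / (A ^ 2 + -1 * r ^ 2) := by rwa [one_le_div hmid2]
    have h4 : A / (A ^ 2 + -1 * r ^ 2) ≤ C := by
      rw [div_le_iff₀ hmid2]; linarith
    constructor <;> linarith

end Frame

/-! ### Law of cosines and angle deformation. -/

section Frame

variable {K : ℝ} {d : ℕ} {x₀ : Ambient d} {b : Fin d → Ambient d}

theorem sinK_geodDist_nonneg (hK : K = 1 ∨ K = -1) {x y : Ambient d}
    (hx : x ∈ spaceForm K d) (hy : y ∈ spaceForm K d) (hxy : K = 1 → form K x y ≠ -1) :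
    0 ≤ sinK K (geodDist K x y) := by
  have hD := (geodDist_sinK hK hx hy hxy).1
  rcases hK with rfl | rfl
  · rw [sinK, if_pos one_pos]
    refine Real.sin_nonneg_of_nonneg_of_le_pi hD ?_
    rw [geodDist, if_pos one_pos]
    exact Real.arccos_le_pi _
  · rw [sinK, if_neg (by norm_num)]
    exact Real.sinh_nonneg_iff.2 hD

/-- The law of cosines. -/
theorem tangentAngle_logMap (hK : K = 1 ∨ K = -1) {x y z : Ambient d}
    (hx : x ∈ spaceForm K d) (hy : y ∈ spaceForm K d) (hz : z ∈ spaceForm K d)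
    (hxy : K = 1 → form K x y ≠ -1) (hxz : K = 1 → form K x z ≠ -1)
    (hSy : sinK K (geodDist K x y) ≠ 0) (hSz : sinK K (geodDist K x z) ≠ 0) :
    tangentAngle K (logMap K x y) (logMap K x z) =
      arccos ((form K y z - K * form K x y * form K x z) /
        (sinK K (geodDist K x y) * sinK K (geodDist K x z))) := by
  have hKK := mul_self_of_curvature hK
  have h1 : form K x x = K := hx.1
  have hS0 : sinK K 0 = 0 := by simp [sinK]
  have hDy : geodDist K x y ≠ 0 := fun h => hSy (by rw [h, hS0])
  have hDz : geodDist K x z ≠ 0 := fun h => hSz (by rw [h, hS0])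
  rw [tangentAngle, (tangentNorm_logMap hK hx hy hxy).2, (tangentNorm_logMap hK hx hz hxz).2]
  congr 1
  simp only [logMap, cosK_geodDist hK hx hy, cosK_geodDist hK hx hz, form_smul_left,
    form_smul_right, sub_eq_add_neg, ← neg_smul, form_add_left, form_add_right, h1,
    form_comm K y x]
  field_simp
  linear_combination K * form K x y * form K x z * hKK

theorem geoMap_base (hb : IsFrame K x₀ b) : geoMap K x₀ b x₀ = 0 := by
  have h2 : ∀ i, form K x₀ (b i) = 0 := hb.1
  ext i
  simp [geoMap, h2]

/-- With `p = ‖u‖²`, `q = ‖w‖²`, `g = ⟨u, w⟩`, one has `(1 + Kp)(1 + Kq) - (1 + Kg)² = K (‖u - w‖² +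
K (pq - g²))`. The sine is nonnegative, so it is the root of its square. -/
theorem sinK_geodDist_geoMapInv (hK : K = 1 ∨ K = -1) (hx₀ : x₀ ∈ spaceForm K d)
    (hb : IsFrame K x₀ b) {u w : EuclideanSpace ℝ (Fin d)}
    (hu : u ∈ mapImage K d) (hw : w ∈ mapImage K d) :
    sinK K (geodDist K (geoMapInv K x₀ b u) (geoMapInv K x₀ b w)) =
      √(‖u - w‖ ^ 2 + K * (‖u‖ ^ 2 * ‖w‖ ^ 2 - inner ℝ u w ^ 2)) /
        (√(1 + K * ‖u‖ ^ 2) * √(1 + K * ‖w‖ ^ 2)) := by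
  have hKK := mul_self_of_curvature hK
  have hum := geoMapInv_mem hK hx₀ hb hu
  have hwm := geoMapInv_mem hK hx₀ hb hw
  have hp0 : 0 < 1 + K * ‖u‖ ^ 2 := hu
  have hq0 : 0 < 1 + K * ‖w‖ ^ 2 := hw
  have h1 := cosK_sq_add hK (geodDist K (geoMapInv K x₀ b u) (geoMapInv K x₀ b w))
  rw [cosK_geodDist hK hum hwm, form_geoMapInv hx₀ hb hK, div_pow, mul_pow, Real.sq_sqrt hp0.le,
    Real.sq_sqrt hq0.le] at h1
  have h2 : sinK K (geodDist K (geoMapInv K x₀ b u) (geoMapInv K x₀ b w)) ^ 2 =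
      (‖u - w‖ ^ 2 + K * (‖u‖ ^ 2 * ‖w‖ ^ 2 - inner ℝ u w ^ 2)) /
        ((1 + K * ‖u‖ ^ 2) * (1 + K * ‖w‖ ^ 2)) := by
    rw [norm_sub_sq_real]
    generalize sinK K _ = S at *
    generalize inner ℝ u w = g at *
    generalize ‖u‖ ^ 2 = p at *
    generalize ‖w‖ ^ 2 = q at *
    rw [eq_div_iff (mul_pos hp0 hq0).ne']
    field_simp at h1
    linear_combination K * h1 + (-S ^ 2 * (1 + K * p) * (1 + K * q) + p + q - 2 * g +
      K * (p * q - g ^ 2)) * hKK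
  rw [← Real.sqrt_mul hp0.le, ← Real.sqrt_div' _ (mul_pos hp0 hq0).le, ← h2,
    Real.sqrt_sq (sinK_geodDist_nonneg hK hum hwm (form_geoMapInv_ne hK hx₀ hb hu hw))]

/-- The spherical or hyperbolic law of cosines, written in the model, collapses to `cos α = cos α' /
√E`. The sine formula then comes from `sin² + cos² = 1`, both sines being nonnegative. -/
theorem angle_deformation (hK : K = 1 ∨ K = -1) (hx₀ : x₀ ∈ spaceForm K d)
    (hb : IsFrame K x₀ b) {u w : EuclideanSpace ℝ (Fin d)}
    (hu : u ∈ mapImage K d) (hw : w ∈ mapImage K d) (hu0 : u ≠ 0) (huw : u ≠ w) {α α' : ℝ}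
    (hα : α = tangentAngle K (logMap K (geoMapInv K x₀ b u) x₀)
      (logMap K (geoMapInv K x₀ b u) (geoMapInv K x₀ b w)))
    (hα' : α' = InnerProductGeometry.angle (-u) (w - u)) :
    sin α = sin α' * √((1 + K * ‖u‖ ^ 2) / (1 + K * ‖u‖ ^ 2 * sin α' ^ 2)) ∧
      cos α = cos α' * √(1 / (1 + K * ‖u‖ ^ 2 * sin α' ^ 2)) := by
  have hKK := mul_self_of_curvature hK
  have hum := geoMapInv_mem hK hx₀ hb hu
  have hwm := geoMapInv_mem hK hx₀ hb hw
  have h0 : (0 : EuclideanSpace ℝ (Fin d)) ∈ mapImage K d := by simp [mapImage]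
  have hx0 : geoMapInv K x₀ b 0 = x₀ := by simp [geoMapInv_eq]
  have hp0 : 0 < 1 + K * ‖u‖ ^ 2 := hu
  have hq0 : 0 < 1 + K * ‖w‖ ^ 2 := hw
  have hup : 0 < ‖u‖ := norm_pos_iff.2 hu0
  have hl : 0 < ‖u - w‖ := norm_pos_iff.2 (sub_ne_zero.2 huw)
  have hcos' : cos α' * (‖u‖ * ‖u - w‖) = ‖u‖ ^ 2 - inner ℝ u w := by
    have h1 := InnerProductGeometry.cos_angle_mul_norm_mul_norm (-u) (w - u)
    rw [← hα', norm_neg, norm_sub_rev, inner_neg_left, inner_sub_right,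
      real_inner_self_eq_norm_sq] at h1
    linarith
  have hsin0 : 0 ≤ sin α' := by
    rw [hα']
    exact Real.sin_nonneg_of_nonneg_of_le_pi (InnerProductGeometry.angle_nonneg _ _)
      (InnerProductGeometry.angle_le_pi _ _)
  have hs1 : sin α' ^ 2 ≤ 1 := Real.sin_sq_le_one α'
  have hc1 : cos α' ^ 2 = 1 - sin α' ^ 2 := Real.cos_sq' α'
  have hE : 0 < 1 + K * ‖u‖ ^ 2 * sin α' ^ 2 := by
    rcases hK with rfl | rfl
    · positivity
    · nlinarith [sq_nonneg ‖u‖]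
  set E := 1 + K * ‖u‖ ^ 2 * sin α' ^ 2 with hEd
  -- The Gram determinant of `u, w` equals that of `u, u - w`, which is `‖u‖² ‖u - w‖² sin² α'`.
  have hQ : ‖u - w‖ ^ 2 + K * (‖u‖ ^ 2 * ‖w‖ ^ 2 - inner ℝ u w ^ 2) = ‖u - w‖ ^ 2 * E := by
    have h1 := norm_sub_sq_real u w
    have h2 : (cos α' * (‖u‖ * ‖u - w‖)) ^ 2 = (‖u‖ ^ 2 - inner ℝ u w) ^ 2 := by rw [hcos']
    rw [mul_pow, hc1] at h2
    linear_combination K * h2 - K * ‖u‖ ^ 2 * h1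
  have hEs := Real.sqrt_pos.2 hE
  have hEsq := Real.sq_sqrt hE.le
  have hps := Real.sqrt_pos.2 hp0
  have hqs := Real.sqrt_pos.2 hq0
  have hS1 := sinK_geodDist_geoMapInv hK hx₀ hb hu h0
  have hS2 := sinK_geodDist_geoMapInv hK hx₀ hb hu hw
  have hF1 := form_geoMapInv hx₀ hb hK u 0
  have hF2 := form_geoMapInv hx₀ hb hK u w
  have hF3 := form_geoMapInv hx₀ hb hK 0 w
  have hn1 := form_geoMapInv_ne hK hx₀ hb hu h0
  have hn2 := form_geoMapInv_ne hK hx₀ hb hu hw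
  rw [hQ, Real.sqrt_mul (by positivity), Real.sqrt_sq hl.le] at hS2
  simp only [hx0, sub_zero, norm_zero, inner_zero_right, inner_zero_left, ne_eq,
    OfNat.ofNat_ne_zero, not_false_eq_true, zero_pow, mul_zero, add_zero, Real.sqrt_one, mul_one,
    one_mul, Real.sqrt_sq hup.le] at hS1 hF1 hF3 hn1
  have hcosα : α = arccos (cos α' / √E) := by
    rw [hα, tangentAngle_logMap hK hum hx₀ hwm hn1 hn2 (by rw [hS1]; positivity)
      (by rw [hS2]; positivity)]
    congr 1
    have e0 : cos α' = (‖u‖ ^ 2 - inner ℝ u w) / (‖u‖ * ‖u - w‖) := by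
      rw [← hcos']; field_simp
    have e1 : form K x₀ (geoMapInv K x₀ b w) - K * form K (geoMapInv K x₀ b u) x₀ *
        form K (geoMapInv K x₀ b u) (geoMapInv K x₀ b w) =
        (‖u‖ ^ 2 - inner ℝ u w) / ((1 + K * ‖u‖ ^ 2) * √(1 + K * ‖w‖ ^ 2)) := by
      have e2 : form K x₀ (geoMapInv K x₀ b w) - K * form K (geoMapInv K x₀ b u) x₀ *
        form K (geoMapInv K x₀ b u) (geoMapInv K x₀ b w) =
          K * (K * form K x₀ (geoMapInv K x₀ b w) - (K * form K (geoMapInv K x₀ b u) x₀) *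
        (K * form K (geoMapInv K x₀ b u) (geoMapInv K x₀ b w))) := by
        linear_combination (K * form K (geoMapInv K x₀ b u) x₀ *
          form K (geoMapInv K x₀ b u) (geoMapInv K x₀ b w) -
          form K x₀ (geoMapInv K x₀ b w)) * hKK
      rw [e2, hF1, hF2, hF3]
      have e3 := Real.sq_sqrt hp0.le
      have e4 : (1 / √(1 + K * ‖u‖ ^ 2)) * ((1 + K * inner ℝ u w) /
          (√(1 + K * ‖u‖ ^ 2) * √(1 + K * ‖w‖ ^ 2))) =
          (1 + K * inner ℝ u w) / ((1 + K * ‖u‖ ^ 2) * √(1 + K * ‖w‖ ^ 2)) := by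
        rw [div_mul_div_comm, one_mul, ← mul_assoc, ← sq, e3]
      rw [e4]
      field_simp
      linear_combination (‖u‖ ^ 2 - inner ℝ u w) * hKK
    rw [e1, e0, hS1, hS2]
    have e3 := Real.mul_self_sqrt hp0.le
    set a := √(1 + K * ‖u‖ ^ 2)
    rw [← e3]
    field_simp
  have hsq : (cos α' / √E) ^ 2 = cos α' ^ 2 / E := by rw [div_pow, hEsq]
  have hle : 1 - (cos α' / √E) ^ 2 = sin α' ^ 2 * ((1 + K * ‖u‖ ^ 2) / E) := by
    rw [hsq, hc1]
    field_simp
    linear_combination hEd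
  have hb1 : (cos α' / √E) ^ 2 ≤ 1 := by
    have : 0 ≤ sin α' ^ 2 * ((1 + K * ‖u‖ ^ 2) / E) := by positivity
    linarith
  constructor
  · rw [hcosα, Real.sin_arccos, hle, Real.sqrt_mul (sq_nonneg _), Real.sqrt_sq hsin0]
  · obtain ⟨h3, h4⟩ := abs_le_of_sq_le_sq' (a := cos α' / √E) (b := 1) (by simpa using hb1)
      zero_le_one
    rw [hcosα, Real.cos_arccos h3 h4, Real.sqrt_div zero_le_one, Real.sqrt_one]
    ring

end Frame

/-! ### The differential of the inverse geodesic map in normal coordinates. -/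

/-- The ambient form as a linear map in its second argument. -/
def formLinear (K : ℝ) {d : ℕ} (x : Ambient d) : Ambient d →ₗ[ℝ] ℝ where
  toFun := form K x
  map_add' p q := form_add_right K p q x
  map_smul' c p := form_smul_right K c p x

theorem continuous_form (K : ℝ) {d : ℕ} (x : Ambient d) : Continuous (form K x) :=
  (formLinear K x).continuous_of_finiteDimensional

section Frame

variable {K : ℝ} {d : ℕ} {x₀ x : Ambient d} {b : Fin d → Ambient d}

/-- The orthogonal projection of the ambient space onto the tangent space at `x`. -/
def tangentProj (hK : K = 1 ∨ K = -1) (hx : x ∈ spaceForm K d) :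
    Ambient d →L[ℝ] tangentSpace K x :=
  LinearMap.toContinuousLinearMap <|
    LinearMap.codRestrict (tangentSpace K x)
      (LinearMap.id - (K • formLinear K x).smulRight x) fun y => by
        change form K x (y - (K * form K x y) • x) = 0
        have h1 : form K x x = K := hx.1
        rw [sub_eq_add_neg, ← neg_smul, form_add_right, form_smul_right, h1]
        linear_combination (-form K x y) * mul_self_of_curvature hK

theorem coe_tangentProj (hK : K = 1 ∨ K = -1) (hx : x ∈ spaceForm K d) (y : Ambient d) :
    (tangentProj hK hx y : Ambient d) = y - (K * form K x y) • x := rfl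

theorem tangentProj_self (hK : K = 1 ∨ K = -1) (hx : x ∈ spaceForm K d) :
    tangentProj hK hx x = 0 := by
  have h1 : form K x x = K := hx.1
  apply Subtype.ext
  rw [coe_tangentProj, h1, mul_self_of_curvature hK, one_smul, sub_self]
  rfl

theorem tangentProj_coe (hK : K = 1 ∨ K = -1) (hx : x ∈ spaceForm K d) (v : tangentSpace K x) :
    tangentProj hK hx v = v := by
  have h1 : form K x v = 0 := v.2
  apply Subtype.ext
  rw [coe_tangentProj, h1, mul_zero, zero_smul, sub_zero]

theorem form_tangentProj (hK : K = 1 ∨ K = -1) (hx : x ∈ spaceForm K d) (y z : Ambient d) :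
    form K (tangentProj hK hx y : Ambient d) (tangentProj hK hx z : Ambient d) =
      form K y z - K * form K x y * form K x z := by
  have h1 : form K x x = K := hx.1
  simp only [coe_tangentProj, sub_eq_add_neg, ← neg_smul, form_add_left, form_add_right,
    form_smul_left, form_smul_right, h1, form_comm K y x]
  linear_combination K * form K x y * form K x z * mul_self_of_curvature hK

/-- Multiplication by a function tending to `1` keeps the derivative at a zero. -/
theorem hasFDerivAt_smul_of_tendsto_one {E G : Type*} [NormedAddCommGroup E] [NormedSpace ℝ E]
    [NormedAddCommGroup G] [NormedSpace ℝ G] {P : E → G} {P' : E →L[ℝ] G} {m : E → ℝ} {u : E}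
    (hP : HasFDerivAt P P' u) (hu : P u = 0) (hm : Tendsto m (𝓝 u) (𝓝 1)) :
    HasFDerivAt (fun z => m z • P z) P' u := by
  -- `m P = (m - 1) P + P`, and the first summand is `o(1) · O(z - u)`; only the limit of `m`
  -- matters, not its differentiability.
  have h1 : HasFDerivAt (fun z => (m z - 1) • P z) (0 : E →L[ℝ] G) u := by
    refine HasFDerivAt.of_isLittleO ?_
    have h2 : (fun z => m z - 1) =o[𝓝 u] (fun _ => (1 : ℝ)) := by
      rw [Asymptotics.isLittleO_one_iff]
      simpa using hm.sub_const 1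
    have h3 := hP.isBigO_sub
    simp only [hu, sub_zero] at h3
    have h4 := h2.smul_isBigO h3
    simpa [hu, Asymptotics.isLittleO_iff, norm_smul] using h4
  have h2 := h1.add hP
  rw [zero_add] at h2
  refine h2.congr_of_eventuallyEq (Eventually.of_forall fun z => ?_)
  simp [sub_smul]

/-- The limit is the inverse of `S_K'(0) = 1`. The value at `0` is set to `1` because division by
zero would give `0` there and spoil the limit over the full neighbourhood. -/
theorem tendsto_div_sinK (hK : K = 1 ∨ K = -1) :
    Tendsto (fun t => if t = 0 then 1 else t / sinK K t) (𝓝 0) (𝓝 1) := by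
  have h0 : sinK K 0 = 0 := by simp [sinK]
  have hc : cosK K 0 = 1 := by simp [cosK]
  have h1 := (hasDerivAt_iff_tendsto_slope.1 (hasDerivAt_sinK hK 0)).inv₀ (by rw [hc]; norm_num)
  rw [hc, inv_one] at h1
  have h2 : Tendsto (fun t => if t = 0 then 1 else t / sinK K t) (𝓝[≠] 0) (𝓝 1) := by
    refine h1.congr' ?_
    filter_upwards [self_mem_nhdsWithin] with t ht
    rw [if_neg (Set.mem_compl_singleton_iff.1 ht)]
    simp [slope_def_field, h0]
  rw [← nhdsNE_sup_pure]
  refine h2.sup ?_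
  rw [tendsto_pure_left]
  intro s hs
  simpa using mem_of_mem_nhds hs

theorem isOpen_mapImage (K : ℝ) (d : ℕ) : IsOpen (mapImage K d) :=
  isOpen_lt continuous_const (by fun_prop)

theorem hasFDerivAt_tangentProj_geoMapInv (hK : K = 1 ∨ K = -1)
    {u : EuclideanSpace ℝ (Fin d)} (hu : u ∈ mapImage K d)
    (hx : geoMapInv K x₀ b u ∈ spaceForm K d) :
    ContinuousAt (geoMapInv K x₀ b) u ∧
    HasFDerivAt (fun z => tangentProj hK hx (geoMapInv K x₀ b z))
      ((√(1 + K * ‖u‖ ^ 2))⁻¹ • (tangentProj hK hx ∘L (frameMap b).toContinuousLinearMap)) u := by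
  have ha : 0 < 1 + K * ‖u‖ ^ 2 := hu
  have hs := Real.sqrt_pos.2 ha
  have hc : DifferentiableAt ℝ (fun z : EuclideanSpace ℝ (Fin d) => (√(1 + K * ‖z‖ ^ 2))⁻¹) u := by
    refine DifferentiableAt.inv (DifferentiableAt.sqrt ?_ ha.ne') hs.ne'
    exact (((contDiff_norm_sq ℝ (n := 1)).differentiable one_ne_zero u).const_mul K).const_add 1
  have hB : HasFDerivAt (fun z => x₀ + frameMap b z) (frameMap b).toContinuousLinearMap u :=
    ((frameMap b).toContinuousLinearMap.hasFDerivAt).const_add x₀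
  have h1 := hc.hasFDerivAt.smul hB
  refine ⟨h1.continuousAt, ?_⟩
  refine ((tangentProj hK hx).hasFDerivAt.comp u h1).congr_fderiv ?_
  -- Differentiating the normalising factor yields a multiple of `x₀ + B u`, hence of the point
  -- itself, which the projection kills.
  have hz : tangentProj hK hx (x₀ + frameMap b u) = 0 := by
    have : x₀ + frameMap b u = √(1 + K * ‖u‖ ^ 2) • geoMapInv K x₀ b u := by
      rw [geoMapInv_eq, smul_smul, mul_inv_cancel₀ hs.ne', one_smul]
    rw [this, map_smul, tangentProj_self, smul_zero]
  ext1 w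
  simp [hz, -map_add, -smul_add]

theorem tendsto_geodDist (hK : K = 1 ∨ K = -1) {u : EuclideanSpace ℝ (Fin d)}
    {p : EuclideanSpace ℝ (Fin d) → Ambient d} (hp : ContinuousAt p u)
    (hm : ∀ᶠ z in 𝓝 u, p z ∈ spaceForm K d) :
    Tendsto (fun z => geodDist K (p u) (p z)) (𝓝 u) (𝓝 0) := by
  have hx := hm.self_of_nhds
  have h1 : form K (p u) (p u) = K := hx.1
  have h2 : Tendsto (fun z => form K (p u) (p z)) (𝓝 u) (𝓝 (form K (p u) (p u))) :=
    ((continuous_form K (p u)).tendsto _).comp hp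
  rw [h1] at h2
  rcases hK with rfl | rfl
  · simp only [geodDist, if_pos one_pos]
    rw [← Real.arccos_one]
    exact (Real.continuous_arccos.tendsto 1).comp h2
  · simp only [geodDist, if_neg (show ¬ (0 : ℝ) < -1 by norm_num)]
    -- `arcosh` is used only on `[1, ∞)`, so nearby points must be shown to give arguments in that
    -- half-line.
    have h3 := Real.continuousOn_arcosh 1 (Set.self_mem_Ici)
    rw [ContinuousWithinAt, Real.arcosh_zero] at h3
    refine h3.comp (tendsto_nhdsWithin_iff.2 ⟨by simpa using h2.neg, ?_⟩)
    filter_upwards [hm] with z hz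
    have h4 := cosK_geodDist (Or.inr rfl) hx hz
    rw [cosK, if_neg (by norm_num)] at h4
    have h5 := Real.one_le_cosh (geodDist (-1) (p u) (p z))
    rw [Set.mem_Ici]
    linarith

/-- The chain rule for the geodesic map. -/
theorem hasFDerivAt_comp_geoMapInv (hK : K = 1 ∨ K = -1) (hx₀ : x₀ ∈ spaceForm K d)
    (hb : IsFrame K x₀ b) {u : EuclideanSpace ℝ (Fin d)} (hu : u ∈ mapImage K d)
    (hx : geoMapInv K x₀ b u ∈ spaceForm K d) {F : Ambient d → ℝ}
    {L : tangentSpace K (geoMapInv K x₀ b u) →L[ℝ] ℝ}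
    (hF : HasFDerivAt (fun v : tangentSpace K (geoMapInv K x₀ b u) =>
      F (expMap K (geoMapInv K x₀ b u) v)) L 0) :
    HasFDerivAt (F ∘ geoMapInv K x₀ b)
      (L ∘L ((√(1 + K * ‖u‖ ^ 2))⁻¹ •
        (tangentProj hK hx ∘L (frameMap b).toContinuousLinearMap))) u := by
  obtain ⟨hcont, hP⟩ := hasFDerivAt_tangentProj_geoMapInv hK hu hx
  have hev : ∀ᶠ z in 𝓝 u, z ∈ mapImage K d := (isOpen_mapImage K d).mem_nhds hu
  have hD := tendsto_geodDist hK hcont (hev.mono fun z hz => geoMapInv_mem hK hx₀ hb hz)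
  have hψ := hasFDerivAt_smul_of_tendsto_one hP (tangentProj_self hK hx)
    ((tendsto_div_sinK hK).comp hD)
  have h0 : ((fun t => if t = 0 then 1 else t / sinK K t) ∘ fun z =>
      geodDist K (geoMapInv K x₀ b u) (geoMapInv K x₀ b z)) u •
      tangentProj hK hx (geoMapInv K x₀ b u) = 0 := by rw [tangentProj_self, smul_zero]
  rw [← h0] at hF
  refine (hF.comp u hψ).congr_of_eventuallyEq ?_
  filter_upwards [hev] with z hz
  have hzm := geoMapInv_mem hK hx₀ hb hz
  have hne := form_geoMapInv_ne hK hx₀ hb hu hz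
  simp only [Function.comp_apply]
  congr 1
  conv_lhs => rw [← expMap_logMap hK hx hzm hne]
  congr 1
  rw [Submodule.coe_smul, coe_tangentProj, logMap, cosK_geodDist hK hx hzm]
  -- At distance zero the two points coincide and the projected vector vanishes, so the artificial
  -- factor `1` is harmless.
  split_ifs with hd
  · have h1 := cosK_geodDist hK hx hzm
    rw [hd, show cosK K 0 = 1 by simp [cosK]] at h1
    have h2 : geoMapInv K x₀ b u = geoMapInv K x₀ b z :=
      eq_of_form_eq hK hx hzm (by rcases hK with rfl | rfl <;> linarith)
    rw [← h1, ← h2]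
    simp
  · rfl

end Frame

/-! ### Pulled-back metric, corresponding vectors and gradients. -/

section Frame

variable {K : ℝ} {d : ℕ} {x₀ : Ambient d} {b : Fin d → Ambient d}

theorem form_geoMapInv_frameMap (hb : IsFrame K x₀ b) (u w : EuclideanSpace ℝ (Fin d)) :
    form K (geoMapInv K x₀ b u) (frameMap b w) = (√(1 + K * ‖u‖ ^ 2))⁻¹ * inner ℝ u w := by
  rw [geoMapInv_eq, form_smul_left, form_add_left, form_frameMap hb, form_comm K x₀,
    form_frameMap_base hb, zero_add]

/-- The metric of the space form read in the geodesic map, up to the factor `1 + K ‖u‖²`. -/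
theorem form_tangentProj_frameMap (hK : K = 1 ∨ K = -1) (hb : IsFrame K x₀ b)
    {u : EuclideanSpace ℝ (Fin d)} (hu : u ∈ mapImage K d)
    (hx : geoMapInv K x₀ b u ∈ spaceForm K d) (w w' : EuclideanSpace ℝ (Fin d)) :
    form K (tangentProj hK hx (frameMap b w) : Ambient d) (tangentProj hK hx (frameMap b w')) =
      inner ℝ w w' - K * inner ℝ u w * inner ℝ u w' / (1 + K * ‖u‖ ^ 2) := by
  have ha : 0 < 1 + K * ‖u‖ ^ 2 := hu
  rw [form_tangentProj, form_frameMap hb, form_geoMapInv_frameMap hb, form_geoMapInv_frameMap hb]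
  have h1 : (√(1 + K * ‖u‖ ^ 2))⁻¹ * (√(1 + K * ‖u‖ ^ 2))⁻¹ = (1 + K * ‖u‖ ^ 2)⁻¹ := by
    rw [← mul_inv, Real.mul_self_sqrt ha.le]
  rw [div_eq_mul_inv, ← h1]
  ring

theorem exists_tangentProj_frameMap_eq (hK : K = 1 ∨ K = -1) (hx₀ : x₀ ∈ spaceForm K d)
    (hb : IsFrame K x₀ b) {u : EuclideanSpace ℝ (Fin d)} (hu : u ∈ mapImage K d)
    (hx : geoMapInv K x₀ b u ∈ spaceForm K d) (v : tangentSpace K (geoMapInv K x₀ b u)) :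
    ∃ w, v = tangentProj hK hx (frameMap b w) := by
  have ha : 0 < 1 + K * ‖u‖ ^ 2 := hu
  have hs := Real.sqrt_pos.2 ha
  obtain ⟨c, w, h⟩ := exists_frame_coords hK hx₀ hb (v : Ambient d)
  -- Trading `c x₀` for a multiple of the point costs `c B u`, and the multiple of the point
  -- projects to zero.
  refine ⟨w - c • u, ?_⟩
  have h1 : (v : Ambient d) =
      (c * √(1 + K * ‖u‖ ^ 2)) • geoMapInv K x₀ b u + frameMap b (w - c • u) := by
    refine h.trans ?_
    rw [geoMapInv_eq, smul_smul, mul_assoc, mul_inv_cancel₀ hs.ne', mul_one, map_sub, map_smul]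
    module
  have h2 := congrArg (tangentProj hK hx) h1
  rwa [tangentProj_coe, map_add, map_smul, tangentProj_self, smul_zero, zero_add] at h2

theorem geoMap_coords (hK : K = 1 ∨ K = -1) (hx₀ : x₀ ∈ spaceForm K d) (hb : IsFrame K x₀ b)
    (c : ℝ) (w : EuclideanSpace ℝ (Fin d)) :
    K * form K (c • x₀ + frameMap b w) x₀ = c ∧ geoMap K x₀ b (c • x₀ + frameMap b w) = c⁻¹ • w := by
  have h := form_frame hx₀ hb c w
  have h1 : K * form K (c • x₀ + frameMap b w) x₀ = c := by
    change K * form K (c • x₀ + ∑ i, w i • b i) x₀ = c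
    rw [h.1]
    linear_combination c * mul_self_of_curvature hK
  refine ⟨h1, ?_⟩
  ext i
  simp only [geoMap, h1, PiLp.smul_apply, smul_eq_mul]
  rw [show form K (c • x₀ + frameMap b w) (b i) = w i from h.2 i, div_eq_inv_mul]

/-- The part in the hemisphere of a spherical geodesic through it is shorter than `π`. -/
theorem sinK_nonneg_of_geodesic (hK : K = 1 ∨ K = -1) {x v : Ambient d}
    (hx : x ∈ mapDomain K x₀) (hn : 0 < tangentNorm K v) {t : ℝ} (ht : 0 ≤ t)
    (hdom : ∀ r ∈ Set.Icc 0 t, expMap K x (r • v) ∈ mapDomain K x₀) :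
    0 ≤ sinK K (t * tangentNorm K v) := by
  rcases hK with rfl | rfl
  · rw [sinK, if_pos one_pos]
    refine Real.sin_nonneg_of_nonneg_of_le_pi (by positivity) ?_
    -- Otherwise the geodesic would pass, at arclength `π`, through the antipode of its start, which
    -- is outside the hemisphere.
    by_contra! h
    have h1 := hdom (π / tangentNorm 1 v) ⟨by positivity, by
      rw [div_le_iff₀ hn]; exact h.le⟩
    rw [expMap_smul, div_mul_cancel₀ _ hn.ne'] at h1
    simp only [cosK, sinK, if_pos one_pos, Real.cos_pi, Real.sin_pi, zero_div, zero_smul,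
      add_zero] at h1
    have h2 := h1.2
    have h3 := hx.2
    rw [form_smul_left] at h2
    linarith
  · rw [sinK, if_neg (by norm_num)]
    exact Real.sinh_nonneg_iff.2 (by positivity)

/-- Corresponding vectors are related, up to a positive factor, by the differential of `h⁻¹`. -/
theorem Corresponds.exists_eq (hK : K = 1 ∨ K = -1) (hx₀ : x₀ ∈ spaceForm K d)
    (hb : IsFrame K x₀ b) {u : EuclideanSpace ℝ (Fin d)} (hu : u ∈ mapImage K d)
    (hx : geoMapInv K x₀ b u ∈ mapDomain K x₀) {v : Ambient d} {w : EuclideanSpace ℝ (Fin d)}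
    (h : Corresponds K x₀ b (geoMapInv K x₀ b u) v w) :
    ∃ κ : ℝ, 0 < κ ∧ v = κ • (tangentProj hK hx.1 (frameMap b w) : Ambient d) := by
  have ha : 0 < 1 + K * ‖u‖ ^ 2 := hu
  have hs := Real.sqrt_pos.2 ha
  obtain ⟨hv, hn, I, hI, h0, hpos, hdom, hset⟩ := h
  rcases eq_or_ne w 0 with rfl | hw
  · refine ⟨1, one_pos, ?_⟩
    rw [norm_zero] at hn
    have := (form_self_nonneg hK hx.1 hv).2 (by rw [← tangentNorm_sq hK hx.1 hv, ← hn]; simp)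
    simp [this]
  have hnpos : 0 < tangentNorm K v := by rw [← hn]; exact norm_pos_iff.2 hw
  obtain ⟨w₁, hw₁⟩ := exists_tangentProj_frameMap_eq hK hx₀ hb hu hx.1 ⟨v, hv⟩
  have hv₁ : v = tangentProj hK hx.1 (frameMap b w₁) := congrArg Subtype.val hw₁
  -- One point of the ray other than its start is enough; it exists because `𝓑` is open.
  obtain ⟨s, hs0, hsm⟩ : ∃ s : ℝ, 0 < s ∧ u + s • w ∈ mapImage K d := by
    have h1 : Tendsto (fun s : ℝ => u + s • w) (𝓝 0) (𝓝 (u + (0 : ℝ) • w)) :=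
      Continuous.tendsto (by fun_prop) 0
    rw [zero_smul, add_zero] at h1
    have h2 := h1.eventually ((isOpen_mapImage K d).mem_nhds hu)
    obtain ⟨s, hs⟩ := ((h2.filter_mono nhdsWithin_le_nhds).and
      (self_mem_nhdsWithin (s := Set.Ioi (0 : ℝ)))).exists
    exact ⟨s, hs.2, hs.1⟩
  have hmem : u + s • w ∈ {z | z ∈ mapImage K d ∧ ∃ s : ℝ, 0 ≤ s ∧
      z = geoMap K x₀ b (geoMapInv K x₀ b u) + s • w} :=
    ⟨hsm, s, hs0.le, by rw [geoMap_geoMapInv hK hx₀ hb hu]⟩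
  rw [hset] at hmem
  obtain ⟨t, htI, ht⟩ := hmem
  have hsin := sinK_nonneg_of_geodesic hK hx hnpos (hpos t htI) fun r hr =>
    hdom r (hI.out h0 htI hr)
  have hd := hdom t htI
  simp only [expMap_smul] at ht hd
  set σ := sinK K (t * tangentNorm K v) / tangentNorm K v with hσ
  have hσ0 : 0 ≤ σ := by positivity
  -- The geodesic stays in the plane of `x` and `v`. As `x` is proportional to `x₀ + B u`, its
  -- points project centrally to `u + (σ / μ) w₁`, so `s w = (σ / μ) w₁`.
  obtain ⟨μ, hμ⟩ : ∃ μ : ℝ, cosK K (t * tangentNorm K v) • geoMapInv K x₀ b u + σ • v =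
      μ • x₀ + frameMap b (μ • u + σ • w₁) := by
    have aux (C β : ℝ) : C • geoMapInv K x₀ b u +
        σ • (frameMap b w₁ - β • geoMapInv K x₀ b u) =
        ((C - σ * β) * (√(1 + K * ‖u‖ ^ 2))⁻¹) • x₀ +
          frameMap b (((C - σ * β) * (√(1 + K * ‖u‖ ^ 2))⁻¹) • u + σ • w₁) := by
      rw [geoMapInv_eq, map_add, map_smul, map_smul]
      module
    exact ⟨_, (congrArg (fun y => cosK K (t * tangentNorm K v) • geoMapInv K x₀ b u + σ • y)
      (hv₁.trans (coe_tangentProj hK hx.1 _))).trans (aux _ _)⟩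
  rw [hμ] at ht hd
  have hg := geoMap_coords hK hx₀ hb μ (μ • u + σ • w₁)
  have hμ0 : 0 < μ := by rw [← hg.1]; exact hd.2
  rw [hg.2, smul_add, smul_smul, inv_mul_cancel₀ hμ0.ne', one_smul, add_right_inj, smul_smul] at ht
  have hσpos : 0 < σ := by
    refine hσ0.lt_of_ne fun h => ?_
    rw [← h, mul_zero, zero_smul] at ht
    exact (smul_ne_zero hs0.ne' hw) ht.symm
  refine ⟨(μ⁻¹ * σ)⁻¹ * s, by positivity, ?_⟩
  have : w₁ = ((μ⁻¹ * σ)⁻¹ * s) • w := by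
    rw [← smul_smul, ← ht, smul_smul, inv_mul_cancel₀ (by positivity), one_smul]
  rw [hv₁, this, map_smul, map_smul]
  rfl

/-- The length of corresponding vectors determines the factor of proportionality. -/
theorem Corresponds.sq_mul_eq (hK : K = 1 ∨ K = -1)
    (hb : IsFrame K x₀ b) {u : EuclideanSpace ℝ (Fin d)} (hu : u ∈ mapImage K d)
    (hx : geoMapInv K x₀ b u ∈ spaceForm K d) {v : Ambient d} {w : EuclideanSpace ℝ (Fin d)}
    (h : Corresponds K x₀ b (geoMapInv K x₀ b u) v w) {κ : ℝ}
    (hκ : v = κ • (tangentProj hK hx (frameMap b w) : Ambient d)) :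
    κ ^ 2 * (‖w‖ ^ 2 - K * inner ℝ u w ^ 2 / (1 + K * ‖u‖ ^ 2)) = ‖w‖ ^ 2 := by
  have h1 := tangentNorm_sq hK hx h.1
  rw [← h.2.1] at h1
  rw [hκ, form_smul_left, form_smul_right, form_tangentProj_frameMap hK hb hu,
    real_inner_self_eq_norm_sq] at h1
  linear_combination -h1

/-- In a basis adapted to `u` the pulled-back metric is diagonal, which gives orthogonality and the
factors `κ`. For the gradient, both sides are tested on vectors `P B w`, which exhaust the tangent
space. -/
theorem gradient_deformation (hK : K = 1 ∨ K = -1) (hx₀ : x₀ ∈ spaceForm K d)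
    (hb : IsFrame K x₀ b) {u : EuclideanSpace ℝ (Fin d)} (hu : u ∈ mapImage K d)
    (hx : geoMapInv K x₀ b u ∈ mapDomain K x₀) {F : Ambient d → ℝ}
    (hF : RiemDifferentiableAt K F (geoMapInv K x₀ b u))
    (e' : OrthonormalBasis (Fin d) ℝ (EuclideanSpace ℝ (Fin d)))
    (e : Fin d → Ambient d) (i₁ : Fin d) (hspan : u ∈ Submodule.span ℝ {e' i₁})
    (he : ∀ i, Corresponds K x₀ b (geoMapInv K x₀ b u) (e i) (e' i)) :
    (∀ i₂, i₂ ≠ i₁ →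
      gradient (F ∘ geoMapInv K x₀ b) u ∈ Submodule.span ℝ {e' i₁, e' i₂} →
        HasRiemGradientAt K F
          (((1 + K * ‖u‖ ^ 2) * inner ℝ (e' i₁) (gradient (F ∘ geoMapInv K x₀ b) u)) • e i₁ +
            (√(1 + K * ‖u‖ ^ 2) * inner ℝ (e' i₂) (gradient (F ∘ geoMapInv K x₀ b) u)) • e i₂)
          (geoMapInv K x₀ b u)) ∧
      ∀ i j, i ≠ j → form K (e i) (e j) = 0 := by
  have ha : 0 < 1 + K * ‖u‖ ^ 2 := hu
  have hs := Real.sqrt_pos.2 ha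
  have hs2 := Real.sq_sqrt ha.le
  obtain ⟨c, rfl⟩ := Submodule.mem_span_singleton.1 hspan
  set u := c • e' i₁ with hud
  have hin (w) : inner ℝ u w = c * inner ℝ (e' i₁) w := real_inner_smul_left _ _ _
  have hon (i j) : inner ℝ (e' i) (e' j) = if i = j then (1 : ℝ) else 0 :=
    orthonormal_iff_ite.1 e'.orthonormal i j
  have hnu : ‖u‖ ^ 2 = c ^ 2 := by
    rw [← real_inner_self_eq_norm_sq, hin, hud, real_inner_smul_right, hon, if_pos rfl]; ring
  choose κ hκ0 hκ using fun i => (he i).exists_eq hK hx₀ hb hu hx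
  have hsq (i) := (he i).sq_mul_eq hK hb hu hx.1 (hκ i)
  simp only [e'.norm_eq_one, one_pow, hin, hon] at hsq
  have hκ₁ : κ i₁ = √(1 + K * ‖u‖ ^ 2) := by
    have h1 := hsq i₁
    rw [if_pos rfl, mul_one, ← hnu, one_sub_div ha.ne', add_sub_cancel_right, mul_one_div,
      div_eq_one_iff_eq ha.ne'] at h1
    rw [← h1, Real.sqrt_sq (hκ0 i₁).le]
  have hκ₂ (i) (hi : i ≠ i₁) : κ i = 1 := by
    have h1 := hsq i
    rw [if_neg hi.symm] at h1
    have h2 := hκ0 i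
    have h3 : κ i ^ 2 = 1 := by linear_combination h1
    exact (pow_eq_one_iff_of_nonneg h2.le two_ne_zero).1 h3
  refine ⟨fun i₂ hi₂ hgrad => ?_, fun i j hij => ?_⟩
  · have hFd := hF.hasFDerivAt
    set L := fderiv ℝ (fun v : tangentSpace K (geoMapInv K x₀ b u) =>
      F (expMap K (geoMapInv K x₀ b u) v)) 0 with hL
    have hf := hasFDerivAt_comp_geoMapInv hK hx₀ hb hu hx.1 hFd
    refine ⟨Submodule.add_mem _ (Submodule.smul_mem _ _ (he i₁).1)
      (Submodule.smul_mem _ _ (he i₂).1), L, fun v => ?_, hFd⟩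
    obtain ⟨w, rfl⟩ := exists_tangentProj_frameMap_eq hK hx₀ hb hu hx.1 v
    have h1 : inner ℝ (gradient (F ∘ geoMapInv K x₀ b) u) w =
        (√(1 + K * ‖u‖ ^ 2))⁻¹ * L (tangentProj hK hx.1 (frameMap b w)) := by
      rw [← InnerProductSpace.toDual_apply_apply, toDual_gradient, hf.fderiv]
      simp
    obtain ⟨p, q, hpq⟩ := Submodule.mem_span_pair.1 hgrad
    rw [← hpq] at h1 ⊢
    rw [hκ i₁, hκ i₂, hκ₁, hκ₂ i₂ hi₂]
    simp only [form_add_left, form_smul_left, form_tangentProj_frameMap hK hb hu hx.1, hin,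
      inner_add_left, inner_add_right, real_inner_smul_left, real_inner_smul_right, hon,
      if_neg hi₂, if_neg hi₂.symm, if_true, mul_zero, mul_one, add_zero, zero_add, zero_mul,
      zero_div, sub_zero] at h1 ⊢
    rw [inv_mul_eq_div, eq_div_iff hs.ne'] at h1
    rw [← h1]
    field_simp
    linear_combination (-p * K * inner ℝ (e' i₁) w) * hnu
  · rw [hκ i, hκ j, form_smul_left, form_smul_right, form_tangentProj_frameMap hK hb hu, hin, hin,
      hon, hon, hon, if_neg hij]
    rcases eq_or_ne i₁ i with rfl | h
    · simp [hij]
    · simp [h]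

/-- By the chain rule `⟨∇f, w⟩` is a multiple of the differential of `F` at `P B w`, and `v` is a
positive multiple of that vector. -/
theorem inner_gradient_eq_zero (hK : K = 1 ∨ K = -1) (hx₀ : x₀ ∈ spaceForm K d)
    (hb : IsFrame K x₀ b) {u : EuclideanSpace ℝ (Fin d)} (hu : u ∈ mapImage K d)
    (hx : geoMapInv K x₀ b u ∈ mapDomain K x₀) {F : Ambient d → ℝ} {G v : Ambient d}
    {w : EuclideanSpace ℝ (Fin d)} (hG : HasRiemGradientAt K F G (geoMapInv K x₀ b u))
    (h : Corresponds K x₀ b (geoMapInv K x₀ b u) v w) (hv : form K G v = 0) :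
    inner ℝ (gradient (F ∘ geoMapInv K x₀ b) u) w = 0 := by
  obtain ⟨-, L, hL, hF⟩ := hG
  obtain ⟨κ, hκ0, hκ⟩ := h.exists_eq hK hx₀ hb hu hx
  rw [← InnerProductSpace.toDual_apply_apply, toDual_gradient,
    (hasFDerivAt_comp_geoMapInv hK hx₀ hb hu hx.1 hF).fderiv]
  rw [hκ, form_smul_right, ← hL] at hv
  have := (mul_eq_zero.1 hv).resolve_left hκ0.ne'
  simp [this]

end Frame

end ConstCurv

end

/-! ### Assembly: points of the geodesic ball are replaced by their model coordinates. -/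

theorem mainTheorem8 (d : ℕ) (K : ℝ) (hK : K = 1 ∨ K = -1) (R : ℝ) (hR : K = 1 → R < Real.pi / 2)
    (x₀ : ConstCurv.Ambient d) (hx₀ : x₀ ∈ ConstCurv.spaceForm K d)
    (b : Fin d → ConstCurv.Ambient d) (hb : ConstCurv.IsFrame K x₀ b)
    (h : ConstCurv.Ambient d → EuclideanSpace ℝ (Fin d)) (hh : h = ConstCurv.geoMap K x₀ b) :
    -- distance deformation
    (∀ x ∈ ConstCurv.geodBall K x₀ R, ∀ y ∈ ConstCurv.geodBall K x₀ R, x ≠ y →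
      K * ConstCurv.cosK K R ^ 2 ≤ K * (ConstCurv.geodDist K x y / ‖h x - h y‖) ∧
      K * (ConstCurv.geodDist K x y / ‖h x - h y‖) ≤ K) ∧
    -- angle deformation
    (∀ x ∈ ConstCurv.geodBall K x₀ R, ∀ y ∈ ConstCurv.geodBall K x₀ R, x ≠ y → x ≠ x₀ →
      ∀ α α' : ℝ,
      α = ConstCurv.tangentAngle K (ConstCurv.logMap K x x₀) (ConstCurv.logMap K x y) →
      α' = InnerProductGeometry.angle (h x₀ - h x) (h y - h x) →
      Real.sin α = Real.sin α' *
        √((1 + K * ‖h x‖ ^ 2) / (1 + K * ‖h x‖ ^ 2 * Real.sin α' ^ 2)) ∧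
      Real.cos α = Real.cos α' * √(1 / (1 + K * ‖h x‖ ^ 2 * Real.sin α' ^ 2))) ∧
    -- gradient deformation
    (∀ x ∈ ConstCurv.geodBall K x₀ R, ∀ F : ConstCurv.Ambient d → ℝ,
      ConstCurv.RiemDifferentiableAt K F x →
      ∀ f : EuclideanSpace ℝ (Fin d) → ℝ, f = F ∘ ConstCurv.geoMapInv K x₀ b →
      DifferentiableAt ℝ f (h x) ∧
      (∀ (e' : OrthonormalBasis (Fin d) ℝ (EuclideanSpace ℝ (Fin d)))
        (e : Fin d → ConstCurv.Ambient d) (i₁ : Fin d),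
        h x ∈ Submodule.span ℝ {e' i₁} →
        (∀ i, ConstCurv.Corresponds K x₀ b x (e i) (e' i)) →
        (∀ i₂, i₂ ≠ i₁ → gradient f (h x) ∈ Submodule.span ℝ {e' i₁, e' i₂} →
          ConstCurv.HasRiemGradientAt K F
            (((1 + K * ‖h x‖ ^ 2) * inner ℝ (e' i₁) (gradient f (h x))) • e i₁ +
              (√(1 + K * ‖h x‖ ^ 2) * inner ℝ (e' i₂) (gradient f (h x))) • e i₂) x) ∧
        ∀ i j, i ≠ j → ConstCurv.form K (e i) (e j) = 0) ∧
      ∀ G, ConstCurv.HasRiemGradientAt K F G x →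
        ∀ v w, ConstCurv.Corresponds K x₀ b x v w → ConstCurv.form K G v = 0 →
          inner ℝ (gradient f (h x)) w = 0) := by
  subst hh
  have key {x : ConstCurv.Ambient d} (hx : x ∈ ConstCurv.geodBall K x₀ R) :
      ∃ u ∈ ConstCurv.mapImage K d, x = ConstCurv.geoMapInv K x₀ b u ∧
        ConstCurv.geoMap K x₀ b x = u ∧ x ∈ ConstCurv.mapDomain K x₀ ∧
        K * (1 + K * ‖u‖ ^ 2) * ConstCurv.cosK K R ^ 2 ≤ K := by
    obtain ⟨h1, h2⟩ := ConstCurv.geodBall_mem hK hR hx₀ hb hx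
    obtain ⟨h3, h4⟩ := ConstCurv.geoMapInv_geoMap hK hx₀ hb h1
    exact ⟨_, h3, h4.symm, rfl, h1, h2⟩
  refine ⟨fun x hx y hy hxy => ?_, fun x hx y hy hxy hxx₀ α α' hα hα' => ?_,
    fun x hx F hF f hf => ?_⟩
  · obtain ⟨u, hu, rfl, hxu, -, hu2⟩ := key hx
    obtain ⟨w, hw, rfl, hyw, -, hw2⟩ := key hy
    rw [hxu, hyw]
    exact ConstCurv.geodDist_geoMapInv_bounds hK hx₀ hb (fun h => hxy (by rw [h])) hu hw hu2 hw2
      (sq_nonneg _)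
  · obtain ⟨u, hu, rfl, hxu, -, -⟩ := key hx
    obtain ⟨w, hw, rfl, hyw, -, -⟩ := key hy
    rw [hxu, hyw, ConstCurv.geoMap_base hb, zero_sub] at hα'
    rw [hxu]
    exact ConstCurv.angle_deformation hK hx₀ hb hu hw
      (fun h => hxx₀ (by simp [h, ConstCurv.geoMapInv_eq])) (fun h => hxy (by rw [h])) hα hα'
  · obtain ⟨u, hu, rfl, hxu, hxd, -⟩ := key hx
    subst hf
    rw [hxu]
    exact ⟨(ConstCurv.hasFDerivAt_comp_geoMapInv hK hx₀ hb hu hxd.1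
        hF.hasFDerivAt).differentiableAt,
      fun e' e i₁ hspan he => ConstCurv.gradient_deformation hK hx₀ hb hu hxd hF e' e i₁ hspan he,
      fun G hG v w hvw hv => ConstCurv.inner_gradient_eq_zero hK hx₀ hb hu hxd hG hvw hv⟩
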